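/- Let $p$ be a prime, $m\ge 1$, $q=p^m$, and let $k$ be a positive integer such that $(k,q)$ is a semiprimitive pair, i.e. either $k=2$ and $q\equiv 1 \pmod 4$, or $k>2$, $m$ is even, $k\mid p^{j}+1$ for some positive divisor $j$ of $m/2$, and $k\neq p^{m/2}+1$. Let $t$ be the least positive integer with $k\mid p^t+1$ and assume that $m=2ts$ for an integer $s$ (this is automatic for $k>2$, and for $k=2$ it says that $m$ is even). Put $$n=\frac{q-1}{k},\qquad \sigma=(-1)^{s+1},\qquad \lambda_2=-\frac{\sigma p^{m/2}+1}{k}.$$ Let $\Gamma=\Gamma(k,q)$ be the generalized Paley graph: its vertex set is the finite field $\mathbb F_q$, with an arrow from $u$ to $v$ if and only if $v-u=x^k$ for some $x\in\mathbb F_q^*$. Then $\Gamma$ is undirected, and, with $\bar\Gamma$ its complement, the following hold. (a) $\Gamma$ and $\bar\Gamma$ are primitive (the graph and its complement are connected), non-bipartite, integral (all eigenvalues of the adjacency matrix are integers) strongly regular graphs (neither complete nor empty), with respective parameters (number of vertices, degree, number of common neighbours of adjacent vertices, number of common neighbours of distinct non-adjacent vertices) $srg(q,n,e,d)$ and $srg(q,(k-1)n,e',d')$,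 where $$d=n+(\sigma p^{m/2}+\lambda_2)\lambda_2,\quad e=d+(\sigma p^{m/2}+2\lambda_2),\quad e'=q-2-2n+d,\quad d'=q-2n+e.$$ (b) $\Gamma$ and $\bar\Gamma$ are distance regular graphs of diameter $2$ with respective intersection arrays $\{b_0,b_1;c_1,c_2\}$ equal to $$\{n,\,n-e-1;\,1,\,d\}\qquad\text{and}\qquad \{(k-1)n,\,n-d;\,1,\,q-2n+e\}.$$ Here $b_i$ (respectively $c_i$) is the number of neighbours of $y$ at distance $i+1$ (respectively $i-1$) from $x$, for any vertices $x,y$ at distance $i$. (c) If $s$ is odd, then each of $\Gamma$ and $\bar\Gamma$ has exactly two non-trivial eigenvalues (eigenvalues different from its degree) $f>0>g$, and it is a pseudo-Latin square graph, that is, with the integers $w=f-g$ and $\delta=-g$ it is strongly regular with parameters $$PL_\delta(w)=srg\big(w^2,\ \delta(w-1),\ \delta^2-3\delta+w,\ \delta(\delta-1)\big).$$ -/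

import Mathlib

/-- The set `R_k` of nonzero `k`-th powers in `F`. -/
def nonzeroPowers (F : Type*) [Field F] (k : ℕ) : Set F :=
  {y | ∃ x : F, x ≠ 0 ∧ x ^ k = y}

/-- The generalized Paley graph `Γ(k, q)`, `q = #F`, as a Cayley digraph: there is an arrow from `u`
to `v` iff `v - u` is a nonzero `k`-th power. -/
def gpDigraph (F : Type*) [Field F] (k : ℕ) : Digraph F where
  Adj u v := v - u ∈ nonzeroPowers F k

/-- The undirected graph obtained from the digraph `Γ(k, q)` by forgetting the orientation. It has
the same adjacency relation as `gpDigraph F k` exactly when the latter is symmetric. -/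
def gpGraph (F : Type*) [Field F] (k : ℕ) : SimpleGraph F :=
  (gpDigraph F k).toSimpleGraphInclusive

/-- `(k, p ^ m)` is a semiprimitive pair: either `k = 2` and `p ^ m ≡ 1 (mod 4)`, or `k > 2`, `m` is
even, `k ∣ p ^ t + 1` for some `t ∣ m / 2`, and `k ≠ p ^ (m / 2) + 1`. -/
def IsSemiprimitivePair (k p m : ℕ) : Prop :=
  p.Prime ∧ 0 < m ∧
    ((k = 2 ∧ p ^ m ≡ 1 [MOD 4]) ∨
      (2 < k ∧ Even m ∧ (∃ t : ℕ, 0 < t ∧ t ∣ m / 2 ∧ k ∣ p ^ t + 1) ∧ k ≠ p ^ (m / 2) + 1))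

namespace SimpleGraph

variable {V : Type*} [Fintype V]

/-- `G` is neither complete nor empty, and it is strongly regular with parameters `srg(v, r, e, d)`.
The parameters are given as real numbers, which have to be natural numbers. -/
def IsStronglyRegular (G : SimpleGraph V) (v r e d : ℝ) : Prop :=
  G ≠ ⊤ ∧ G ≠ ⊥ ∧ ∃ v' r' e' d' : ℕ, (v' : ℝ) = v ∧ (r' : ℝ) = r ∧ (e' : ℝ) = e ∧ (d' : ℝ) = d ∧
    (by classical exact G.IsSRGWith v' r' e' d')

/-- Primitive (said of strongly regular graphs): both the graph and its complement are connected. -/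
def IsPrimitive (G : SimpleGraph V) : Prop :=
  G.Connected ∧ Gᶜ.Connected

/-- The set of eigenvalues of (the adjacency matrix of) `G`; they are all real since the matrix is
real symmetric. -/
noncomputable def eigenvalueSet (G : SimpleGraph V) : Set ℝ := by
  classical exact {μ | Module.End.HasEigenvalue (Matrix.toLin' (G.adjMatrix ℝ)) μ}

/-- All eigenvalues of `G` are integers. -/
def IsIntegral (G : SimpleGraph V) : Prop :=
  ∀ μ ∈ G.eigenvalueSet, ∃ z : ℤ, μ = z

/-- A connected regular graph such that the number of vertices at distance `i` from `x` and at
distance `j` from `y` depends only on `i`, `j` and the distance between `x` and `y`. -/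
def IsDistanceRegular (G : SimpleGraph V) : Prop :=
  G.Connected ∧ (∃ r : ℕ, ∀ x, (G.neighborSet x).ncard = r) ∧
    ∃ c : ℕ → ℕ → ℕ → ℕ, ∀ (x y : V) (i j : ℕ),
      {z | G.dist x z = i ∧ G.dist y z = j}.ncard = c i j (G.dist x y)

/-- `G` has intersection array `{b 0, …, b (D - 1); c 0, …, c (D - 1)}`, where `b i` is the number
of neighbours of `y` at distance `i + 1` from `x` whenever `x`, `y` are at distance `i`, and `c i`
(the `(i + 1)`-st intersection number `c`) is the number of neighbours of `y` at distance `i` from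
`x` whenever `x`, `y` are at distance `i + 1`. -/
def HasIntersectionArray (G : SimpleGraph V) {D : ℕ} (b c : Fin D → ℝ) : Prop :=
  G.Connected ∧ G.diam = D ∧ ∀ (i : Fin D) (x y : V),
    (G.dist x y = i → ({z | G.Adj y z ∧ G.dist x z = i + 1}.ncard : ℝ) = b i) ∧
    (G.dist x y = i + 1 → ({z | G.Adj y z ∧ G.dist x z = i}.ncard : ℝ) = c i)

/-- `G` is a pseudo-Latin square graph `PL_δ(w)`. -/
def IsPseudoLatinSquare (G : SimpleGraph V) (δ w : ℕ) : Prop :=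
  G.IsStronglyRegular ((w : ℝ) ^ 2) (δ * ((w : ℝ) - 1)) ((δ : ℝ) ^ 2 - 3 * δ + w)
    (δ * ((δ : ℝ) - 1))

/-- The eigenvalues of `G` other than `r` are exactly two numbers `f > 0 > g`, and `G` is a
pseudo-Latin square graph `PL_δ(w)` with `w = f - g` and `δ = -g`. -/
def IsSpectralPseudoLatinSquare (G : SimpleGraph V) (r : ℝ) : Prop :=
  ∃ f g : ℝ, 0 < f ∧ g < 0 ∧ G.eigenvalueSet \ {r} = {f, g} ∧
    ∃ δ w : ℕ, (w : ℝ) = f - g ∧ (δ : ℝ) = -g ∧ G.IsPseudoLatinSquare δ w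

end SimpleGraph

/-! Write `Q = p ^ t` and `ρ = σ p ^ (m / 2)`, so that `ρ = -(-Q) ^ s` and `q = ρ ^ 2`. The graph is
a Cayley graph on the additive group of the field, with connection set `R` the nonzero `k`-th
powers, so everything rests on the Gaussian periods `∑ y ∈ R, ψ (a * y)`, `a ≠ 0`.

For exponent `Q + 1`, a multiple of `k`, the Weil sum `∑ x, ψ (a * x ^ (Q + 1))` is a Hermitian-type
sum. Its square is `q` times the size of a radical, which is `1` or `Q ^ 2` (`weilSum_sq`,
`ncard_hermitianKernel`). The sign is forced by a congruence modulo `Q + 1` (`weilSum_eq`).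
Averaging over cosets descends to `k`-th powers: the periods take only the values `l` and `l + ρ`,
with `k * l = -(ρ + 1)` (`sum_powerFinset_eq_or_eq`).

A symmetric set with two nontrivial character values is a partial difference set, and Fourier
inversion gives the strongly regular parameters `(1 - ρ) * l`, `l * (l + 1) + ρ + 2 * l`, `l * (l +
1)` (`gpGraph_isSRGWith`). The semiprimitive hypothesis excludes `l = -1`, and `l = 0` is
impossible, so distinct non-adjacent vertices have common neighbours and the diameter is `2`. The
rest is general theory of strongly regular graphs. For `s` odd, `ρ > 0` gives `l < 0 < l + ρ`, and
the parameters take pseudo-Latin form with `w = ρ`. -/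

namespace SimpleGraph

/-! ### Strongly regular graphs of diameter two: bipartiteness, distance regularity, intersection
arrays. -/

section StronglyRegular

variable {V : Type*} {G : SimpleGraph V} {v r e d : ℕ}

theorem connected_of_ediam_eq_two [Nonempty V] (h : G.ediam = 2) : G.Connected :=
  connected_of_ediam_ne_top (by rw [h]; exact ENat.ofNat_ne_top 2)

theorem dist_eq_two_iff_of_ediam_eq_two [Nonempty V] (h : G.ediam = 2) {x y : V} :
    G.dist x y = 2 ↔ x ≠ y ∧ ¬ G.Adj x y := by
  have hc := connected_of_ediam_eq_two h
  have hle : G.dist x y ≤ 2 := by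
    have := G.dist_le_diam (by rw [h]; exact ENat.ofNat_ne_top 2) (u := x) (v := y)
    simpa [diam, h] using this
  constructor
  · intro h2
    refine ⟨?_, fun ha => ?_⟩
    · rintro rfl
      simp at h2
    · rw [dist_eq_one_iff_adj.2 ha] at h2
      omega
  · rintro ⟨hne, ha⟩
    have := hc.one_lt_dist_of_ne_of_not_adj hne ha
    omega

theorem dist_le_two_of_ediam_eq_two (h : G.ediam = 2) (x y : V) : G.dist x y ≤ 2 := by
  have := G.dist_le_diam (by rw [h]; exact ENat.ofNat_ne_top 2) (u := x) (v := y)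
  simpa [diam, h] using this

/-- In a 2-colouring, distinct non-adjacent vertices share a neighbour and hence a colour.
Connectedness of the complement then makes the colouring constant, contradicting the existence of an
edge. -/
theorem not_isBipartite_of_ediam_eq_two (h2 : G.ediam = 2) (hc : Gᶜ.Connected) :
    ¬ G.IsBipartite := by
  rintro ⟨C⟩
  have : Nontrivial V := nontrivial_of_ediam_ne_zero (G := G) (by rw [h2]; simp)
  have hG : G.Connected := connected_of_ediam_eq_two h2
  obtain ⟨x, y, hxy⟩ : ∃ x y, G.Adj x y := by
    obtain ⟨x⟩ := hG.nonempty
    exact ⟨x, hG.preconnected.exists_adj_of_nontrivial x⟩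
  have two (a b c : Fin 2) (h1 : a ≠ b) (h2 : b ≠ c) : a = c := by omega
  have hcol (a b : V) (hab : Gᶜ.Adj a b) : C a = C b := by
    rw [compl_adj] at hab
    have hd := (dist_eq_two_iff_of_ediam_eq_two h2).2 hab
    obtain ⟨w, hw⟩ := hG.exists_walk_length_eq_dist a b
    rw [hd] at hw
    obtain ⟨z, hz⟩ : (G.commonNeighbors a b).Nonempty := by
      rw [← Set.nonempty_coe_sort]
      exact ⟨G.walkLengthTwoEquivCommonNeighbors a b ⟨w, hw⟩⟩
    rw [mem_commonNeighbors] at hz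
    exact two _ _ _ (C.valid hz.1) (C.valid hz.2.symm)
  have hall (a b : V) : C a = C b := by
    obtain ⟨w⟩ := hc.preconnected a b
    induction w with
    | nil => rfl
    | cons hadj _ ih => exact (hcol _ _ hadj).trans ih
  exact C.valid hxy (hall x y)

variable [Fintype V]

theorem IsSRGWith.ncard_neighborSet [DecidableRel G.Adj] (h : G.IsSRGWith v r e d) (x : V) :
    {z | G.Adj x z}.ncard = r := by
  have := h.regular x
  rw [← G.card_neighborSet_eq_degree, ← Nat.card_eq_fintype_card] at this
  exact this

theorem IsSRGWith.ncard_of_adj [DecidableRel G.Adj] (h : G.IsSRGWith v r e d) {x y : V}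
    (hxy : G.Adj x y) : {z | G.Adj x z ∧ G.Adj y z}.ncard = e := by
  have := h.of_adj x y hxy
  rw [← Nat.card_eq_fintype_card] at this
  exact this

theorem IsSRGWith.ncard_of_not_adj [DecidableRel G.Adj] (h : G.IsSRGWith v r e d) {x y : V}
    (hne : x ≠ y) (hxy : ¬ G.Adj x y) : {z | G.Adj x z ∧ G.Adj y z}.ncard = d := by
  have := h.of_not_adj hne hxy
  rw [← Nat.card_eq_fintype_card] at this
  exact this

theorem ncard_dist_eq_add [Nonempty V] (h : G.ediam = 2) (S : Set V) (y : V) :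
    S.ncard = {z | z ∈ S ∧ G.dist y z = 0}.ncard + {z | z ∈ S ∧ G.dist y z = 1}.ncard
      + {z | z ∈ S ∧ G.dist y z = 2}.ncard := by
  rw [← Set.ncard_union_eq, ← Set.ncard_union_eq]
  · congr 1
    ext z
    have := dist_le_two_of_ediam_eq_two h y z
    simp only [Set.mem_union, Set.mem_ofPred_eq]
    have h3 : G.dist y z = 0 ∨ G.dist y z = 1 ∨ G.dist y z = 2 := by omega
    tauto
  · rw [Set.disjoint_left]
    rintro z (hz | hz) hz' <;> simp only [Set.mem_ofPred_eq] at hz hz' <;> omega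
  · rw [Set.disjoint_left]
    rintro z hz hz'
    simp only [Set.mem_ofPred_eq] at hz hz'
    omega

/-- Only distances `0`, `1`, `2` occur. The counts with an index `0` are immediate and the `(1, 1)`
count is `r`, `e` or `d`; the others follow because the sphere sizes are constant and equal the row
sums of the table. -/
theorem IsSRGWith.isDistanceRegular [DecidableRel G.Adj] [Nonempty V] (h : G.IsSRGWith v r e d)
    (h2 : G.ediam = 2) : G.IsDistanceRegular := by
  have hc := connected_of_ediam_eq_two h2
  refine ⟨hc, ⟨r, h.ncard_neighborSet⟩, ?_⟩
  let N : ℕ → ℕ → V → V → ℕ := fun i j x y => {z | G.dist x z = i ∧ G.dist y z = j}.ncard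
  have symm (i j x y) : N i j x y = N j i y x := by
    simp only [N, and_comm]
  have N0 (j x y) : N 0 j x y = if G.dist x y = j then 1 else 0 := by
    simp only [N, hc.dist_eq_zero_iff]
    split_ifs with hj
    · rw [Set.ncard_eq_one]
      refine ⟨x, ?_⟩
      ext z
      simp only [Set.mem_ofPred_eq, Set.mem_singleton_iff]
      constructor
      · exact fun hz => hz.1.symm
      · rintro rfl
        exact ⟨rfl, by rw [dist_comm]; exact hj⟩
    · rw [Set.ncard_eq_zero]
      ext z
      simp only [Set.mem_ofPred_eq, Set.mem_empty_iff_false, iff_false, not_and]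
      rintro rfl
      rwa [dist_comm]
  have N3 (i j x y) (hi : 2 < i) : N i j x y = 0 := by
    simp only [N]
    rw [Set.ncard_eq_zero]
    ext z
    have := dist_le_two_of_ediam_eq_two h2 x z
    simp only [Set.mem_ofPred_eq, Set.mem_empty_iff_false, iff_false, not_and]
    omega
  have K0 (x) : {z | G.dist x z = 0}.ncard = 1 := by
    simp [hc.dist_eq_zero_iff]
  have K1 (x) : {z | G.dist x z = 1}.ncard = r := by
    simpa only [dist_eq_one_iff_adj] using h.ncard_neighborSet x
  have K2 (x) : 1 + r + {z | G.dist x z = 2}.ncard = v := by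
    have := ncard_dist_eq_add h2 Set.univ x
    simp only [Set.mem_univ, true_and, K0, K1, Set.ncard_univ, Nat.card_eq_fintype_card,
      h.card] at this
    omega
  have S (i x y) : {z | G.dist x z = i}.ncard = N i 0 x y + N i 1 x y + N i 2 x y :=
    ncard_dist_eq_add h2 {z | G.dist x z = i} y
  have N11 (x y) : (G.dist x y = 0 → N 1 1 x y = r) ∧ (G.dist x y = 1 → N 1 1 x y = e) ∧
      (G.dist x y = 2 → N 1 1 x y = d) := by
    refine ⟨fun hxy => ?_, fun hxy => ?_, fun hxy => ?_⟩
    · rw [hc.dist_eq_zero_iff] at hxy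
      subst hxy
      simp only [N, and_self, K1]
    · simp only [N, dist_eq_one_iff_adj]
      exact h.ncard_of_adj (dist_eq_one_iff_adj.1 hxy)
    · simp only [N, dist_eq_one_iff_adj]
      obtain ⟨h3, h4⟩ := (dist_eq_two_iff_of_ediam_eq_two h2).1 hxy
      exact h.ncard_of_not_adj h3 h4
  have key (i j x y x' y') (hxy : G.dist x y = G.dist x' y') : N i j x y = N i j x' y' := by
    have a0 (j) : N 0 j x y = N 0 j x' y' := by simp only [N0, hxy]
    have a0' (j) : N j 0 x y = N j 0 x' y' := by
      rw [symm j 0 x, symm j 0 x', N0, N0, G.dist_comm, hxy, G.dist_comm]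
    have a11 : N 1 1 x y = N 1 1 x' y' := by
      have := dist_le_two_of_ediam_eq_two h2 x y
      obtain h3 | h3 | h3 : G.dist x y = 0 ∨ G.dist x y = 1 ∨ G.dist x y = 2 := by omega
      · rw [(N11 x y).1 h3, (N11 x' y').1 (hxy ▸ h3)]
      · rw [(N11 x y).2.1 h3, (N11 x' y').2.1 (hxy ▸ h3)]
      · rw [(N11 x y).2.2 h3, (N11 x' y').2.2 (hxy ▸ h3)]
    have a12 : N 1 2 x y = N 1 2 x' y' := by
      have b := S 1 x y
      have b' := S 1 x' y'
      rw [K1] at b b'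
      have := a0' 1
      omega
    have a21 : N 2 1 x y = N 2 1 x' y' := by
      have b := S 1 y x
      have b' := S 1 y' x'
      rw [K1] at b b'
      rw [symm 1 0, symm 1 1, symm 1 2] at b b'
      have := a0 1
      omega
    have a22 : N 2 2 x y = N 2 2 x' y' := by
      have b := S 2 x y
      have b' := S 2 x' y'
      have c := K2 x
      have c' := K2 x'
      have := a0' 2
      omega
    rcases lt_or_ge 2 i with hi | hi
    · rw [N3 _ _ _ _ hi, N3 _ _ _ _ hi]
    rcases lt_or_ge 2 j with hj | hj
    · rw [symm, symm i j, N3 _ _ _ _ hj, N3 _ _ _ _ hj]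
    interval_cases i <;> interval_cases j <;> first | assumption | exact a0 _ | exact a0' _
  classical
  -- The constants are read off from any pair at distance `l`; the value `0` for unattained
  -- distances is never used.
  refine ⟨fun i j l => if hl : ∃ xy : V × V, G.dist xy.1 xy.2 = l then
    N i j hl.choose.1 hl.choose.2 else 0, fun x y i j => ?_⟩
  have hl : ∃ xy : V × V, G.dist xy.1 xy.2 = G.dist x y := ⟨(x, y), rfl⟩
  beta_reduce
  rw [dif_pos hl]
  exact key _ _ _ _ _ _ hl.choose_spec.symm

theorem IsSRGWith.hasIntersectionArray [DecidableRel G.Adj] [Nonempty V]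
    (h : G.IsSRGWith v r e d) (h2 : G.ediam = 2) {b₀ b₁ c₁ c₂ : ℝ} (hb₀ : b₀ = r)
    (hb₁ : b₁ = r - e - 1) (hc₁ : c₁ = 1) (hc₂ : c₂ = d) :
    G.HasIntersectionArray ![b₀, b₁] ![c₁, c₂] := by
  have hc := connected_of_ediam_eq_two h2
  refine ⟨hc, by simp [diam, h2], fun i x y => ?_⟩
  fin_cases i
  · simp only [Fin.zero_eta, zero_add, Matrix.cons_val_zero]
    refine ⟨fun hxy => ?_, fun hxy => ?_⟩
    · rw [hc.dist_eq_zero_iff] at hxy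
      subst hxy
      simp only [dist_eq_one_iff_adj, and_self, h.ncard_neighborSet, hb₀]
    · rw [dist_eq_one_iff_adj] at hxy
      have : {z | G.Adj y z ∧ G.dist x z = 0} = {x} := by
        ext z
        simp only [hc.dist_eq_zero_iff, Set.mem_ofPred_eq, Set.mem_singleton_iff]
        constructor
        · exact fun hz => hz.2.symm
        · rintro rfl
          exact ⟨hxy.symm, rfl⟩
      rw [this, hc₁]
      simp
  · simp only [Fin.mk_one, one_add_one_eq_two, Matrix.cons_val_one,
      Matrix.cons_val_zero]
    refine ⟨fun hxy => ?_, fun hxy => ?_⟩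
    · rw [dist_eq_one_iff_adj] at hxy
      have := ncard_dist_eq_add h2 {z | G.Adj y z} x
      have h0 : {z | z ∈ {z | G.Adj y z} ∧ G.dist x z = 0} = {x} := by
        ext z
        simp only [hc.dist_eq_zero_iff, Set.mem_ofPred_eq, Set.mem_singleton_iff]
        constructor
        · exact fun hz => hz.2.symm
        · rintro rfl
          exact ⟨hxy.symm, rfl⟩
      rw [h.ncard_neighborSet, h0, Set.ncard_singleton] at this
      simp only [Set.mem_ofPred_eq, dist_eq_one_iff_adj] at this
      rw [h.ncard_of_adj hxy.symm] at this
      rw [hb₁, this]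
      push_cast
      ring
    · obtain ⟨h3, h4⟩ := (dist_eq_two_iff_of_ediam_eq_two h2).1 hxy
      simp only [dist_eq_one_iff_adj]
      rw [hc₂, h.ncard_of_not_adj (x := y) (y := x) h3.symm (fun h => h4 h.symm)]

end StronglyRegular

/-! ### The spectrum of a strongly regular graph. -/

section Spectrum

open Matrix

variable {V : Type*} [Fintype V] {G : SimpleGraph V} [DecidableRel G.Adj] {v r e d : ℕ}

theorem IsSRGWith.sum_adjMatrix_mulVec (h : G.IsSRGWith v r e d) (x : V → ℝ) :
    ∑ i, (G.adjMatrix ℝ *ᵥ x) i = r * ∑ i, x i := by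
  simp only [Matrix.mulVec, dotProduct]
  rw [Finset.sum_comm, Finset.mul_sum]
  refine Finset.sum_congr rfl fun j _ => ?_
  rw [← Finset.sum_mul]
  congr 1
  have := h.regular j
  simp only [adjMatrix_apply, Finset.sum_boole]
  rw [← this, ← card_neighborFinset_eq_degree]
  congr 2
  ext i
  simp [adj_comm]

variable [DecidableEq V]

theorem mem_eigenvalueSet_iff {μ : ℝ} :
    μ ∈ G.eigenvalueSet ↔ ∃ x : V → ℝ, x ≠ 0 ∧ G.adjMatrix ℝ *ᵥ x = μ • x := by
  have : G.eigenvalueSet = {μ | Module.End.HasEigenvalue (Matrix.toLin' (G.adjMatrix ℝ)) μ} := by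
    unfold eigenvalueSet
    congr!
  rw [this, Set.mem_ofPred_eq]
  constructor
  · intro h
    obtain ⟨x, hx⟩ := h.exists_hasEigenvector
    exact ⟨x, hx.2, by simpa using hx.apply_eq_smul⟩
  · rintro ⟨x, hx, h⟩
    exact Module.End.hasEigenvalue_of_hasEigenvector
      (Module.End.hasEigenvector_iff.2 ⟨Module.End.mem_eigenspace_iff.2 (by simpa using h), hx⟩)

/-- On vectors of coordinate sum zero the all-ones matrix vanishes, so the identity for the square
of the adjacency matrix `A` becomes `(A - f) (A - g) = 0`. -/
theorem IsSRGWith.adjMatrix_mulVec_mulVec (h : G.IsSRGWith v r e d) {f g : ℝ}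
    (hsum : f + g = e - d) (hprod : f * g = d - r) (x : V → ℝ) (hx : ∑ i, x i = 0) :
    G.adjMatrix ℝ *ᵥ (G.adjMatrix ℝ *ᵥ x) = (f + g) • (G.adjMatrix ℝ *ᵥ x) - (f * g) • x := by
  have h1 : G.adjMatrix ℝ ^ 2 = (r : ℝ) • (1 : Matrix V V ℝ) + (e : ℝ) • G.adjMatrix ℝ
      + (d : ℝ) • Gᶜ.adjMatrix ℝ := by
    rw [h.matrix_eq]
    simp only [Nat.cast_smul_eq_nsmul]
  have h2 : Gᶜ.adjMatrix ℝ *ᵥ x = - x - G.adjMatrix ℝ *ᵥ x := by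
    have : (1 : Matrix V V ℝ) + G.adjMatrix ℝ + Gᶜ.adjMatrix ℝ = Matrix.of fun _ _ => 1 := by
      ext i j
      by_cases hij : i = j
      · simp [hij]
      · by_cases ha : G.Adj i j <;> simp [hij, ha]
    have h3 := congrArg (· *ᵥ x) this
    have h4 : (Matrix.of fun _ _ => 1 : Matrix V V ℝ) *ᵥ x = 0 := by
      ext i
      simp [Matrix.mulVec, dotProduct, hx]
    simp only [Matrix.add_mulVec, Matrix.one_mulVec, h4] at h3
    rw [eq_sub_iff_add_eq, eq_neg_iff_add_eq_zero, ← h3]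
    abel
  rw [Matrix.mulVec_mulVec, ← pow_two, h1, Matrix.add_mulVec, Matrix.add_mulVec,
    Matrix.smul_mulVec, Matrix.smul_mulVec, Matrix.smul_mulVec, h2, Matrix.one_mulVec, hsum, hprod]
  module

theorem IsSRGWith.eq_of_mem_eigenvalueSet (h : G.IsSRGWith v r e d) {f g : ℝ}
    (hsum : f + g = e - d) (hprod : f * g = d - r) {μ : ℝ} (hμ : μ ∈ G.eigenvalueSet) :
    μ = r ∨ μ = f ∨ μ = g := by
  obtain ⟨x, hx, hxμ⟩ := mem_eigenvalueSet_iff.1 hμ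
  by_cases hs : ∑ i, x i = 0
  · right
    have h1 := h.adjMatrix_mulVec_mulVec hsum hprod x hs
    rw [hxμ, Matrix.mulVec_smul, hxμ, smul_smul, smul_smul, ← sub_smul, ← sub_eq_zero,
      ← sub_smul] at h1
    have h2 := (smul_eq_zero.1 h1).resolve_right hx
    have h3 : (μ - f) * (μ - g) = 0 := by linear_combination h2
    simpa [sub_eq_zero] using h3
  · left
    have h1 := h.sum_adjMatrix_mulVec x
    rw [hxμ] at h1
    simp only [Pi.smul_apply, smul_eq_mul, ← Finset.mul_sum] at h1
    exact mul_right_cancel₀ hs h1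

theorem IsSRGWith.mem_eigenvalueSet (h : G.IsSRGWith v r e d) {f g : ℝ}
    (hsum : f + g = e - d) (hprod : f * g = d - r) (htop : G ≠ ⊤) (hg : g ≠ 0) :
    f ∈ G.eigenvalueSet := by
  obtain ⟨a, b, hne, hab⟩ : ∃ a b, a ≠ b ∧ ¬ G.Adj a b := by
    by_contra! hall
    exact htop (eq_top_iff.2 fun a b hab => hall a b hab)
  -- `(A - g) x` is killed by `A - f`. It is nonzero because `a`, `b` are non-adjacent: its
  -- coordinate at `a` is `-g`.
  set x : V → ℝ := Pi.single a 1 - Pi.single b 1 with hx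
  have hs : ∑ i, x i = 0 := by simp [hx, Finset.sum_sub_distrib]
  refine mem_eigenvalueSet_iff.2 ⟨G.adjMatrix ℝ *ᵥ x - g • x, fun h0 => ?_, ?_⟩
  · have := congrFun h0 a
    simp [hx, Matrix.mulVec_sub, hne, hab, hg] at this
  · rw [Matrix.mulVec_sub, Matrix.mulVec_smul, h.adjMatrix_mulVec_mulVec hsum hprod x hs]
    module

theorem IsSRGWith.eigenvalueSet_sdiff (h : G.IsSRGWith v r e d) {f g : ℝ}
    (hsum : f + g = e - d) (hprod : f * g = d - r) (htop : G ≠ ⊤) (hf : f ≠ 0) (hg : g ≠ 0)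
    (hfr : f ≠ r) (hgr : g ≠ r) : G.eigenvalueSet \ {(r : ℝ)} = {f, g} := by
  ext μ
  simp only [Set.mem_sdiff, Set.mem_singleton_iff, Set.mem_insert_iff]
  constructor
  · rintro ⟨h1, h2⟩
    exact (h.eq_of_mem_eigenvalueSet hsum hprod h1).resolve_left h2
  · rintro (rfl | rfl)
    · exact ⟨h.mem_eigenvalueSet hsum hprod htop hg, hfr⟩
    · exact ⟨h.mem_eigenvalueSet (by rw [add_comm]; exact hsum) (by rw [mul_comm]; exact hprod)
        htop hf, hgr⟩

end Spectrum

end SimpleGraph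

/-! ### Powers in the cyclic group of a finite field, and sums over them. -/

section PowerSums

variable {F : Type*} [Field F] [Fintype F]

theorem exists_isPrimitiveRoot_card_sub_one (F : Type*) [Field F] [Fintype F] :
    ∃ g : F, IsPrimitiveRoot g (Fintype.card F - 1) ∧ ∀ x : F, x ≠ 0 → ∃ i : ℕ, x = g ^ i := by
  classical
  obtain ⟨g, hg⟩ := IsCyclic.exists_generator (α := Fˣ)
  refine ⟨g, ?_, fun x hx => ?_⟩
  · rw [IsPrimitiveRoot.coe_units_iff, IsPrimitiveRoot.iff_orderOf,
      orderOf_eq_card_of_forall_mem_zpowers hg, Nat.card_eq_fintype_card, Fintype.card_units]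
  · obtain ⟨i, hi⟩ := mem_powers_iff_mem_zpowers.2 (hg (Units.mk0 x hx))
    refine ⟨i, ?_⟩
    have := congrArg Units.val hi
    simpa using this.symm

theorem exists_isPrimitiveRoot_of_dvd {N : ℕ} (hN : N ∣ Fintype.card F - 1) :
    ∃ u : F, IsPrimitiveRoot u N := by
  obtain ⟨g, hg, -⟩ := exists_isPrimitiveRoot_card_sub_one F
  obtain ⟨L, hL⟩ := hN
  exact ⟨g ^ L, hg.pow (Nat.sub_pos_of_lt Fintype.one_lt_card) (by rw [hL, mul_comm])⟩

theorem exists_pow_eq_of_pow_eq_one {N L : ℕ} (h : Fintype.card F - 1 = N * L) {c : F}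
    (hc : c ^ L = 1) : ∃ y : F, y ≠ 0 ∧ y ^ N = c := by
  obtain ⟨g, hg, hgen⟩ := exists_isPrimitiveRoot_card_sub_one F
  have hpos : 0 < N * L := h ▸ Nat.sub_pos_of_lt Fintype.one_lt_card
  have hL : 0 < L := Nat.pos_of_mul_pos_left hpos
  have hc0 : c ≠ 0 := by
    rintro rfl
    rw [zero_pow hL.ne'] at hc
    exact zero_ne_one hc
  obtain ⟨i, rfl⟩ := hgen c hc0
  rw [← pow_mul, hg.pow_eq_one_iff_dvd, h] at hc
  obtain ⟨j, rfl⟩ := Nat.dvd_of_mul_dvd_mul_right hL hc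
  refine ⟨g ^ j, pow_ne_zero _ (hg.ne_zero (h ▸ hpos.ne')), ?_⟩
  rw [← pow_mul, mul_comm]

variable [DecidableEq F]

/-- The finite set of nonzero `k`-th powers. -/
def powerFinset (F : Type*) [Field F] [Fintype F] [DecidableEq F] (k : ℕ) : Finset F :=
  (Finset.univ.erase 0).image (· ^ k)

theorem mem_powerFinset {k : ℕ} {y : F} : y ∈ powerFinset F k ↔ ∃ x : F, x ≠ 0 ∧ x ^ k = y := by
  simp [powerFinset]

theorem card_filter_pow_eq {k : ℕ} (hk : k ∣ Fintype.card F - 1) {y : F}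
    (hy : y ∈ powerFinset F k) : ((Finset.univ.erase (0 : F)).filter (· ^ k = y)).card = k := by
  obtain ⟨u, hu⟩ := exists_isPrimitiveRoot_of_dvd hk
  have hk0 : 0 < k := Nat.pos_of_dvd_of_pos hk (Nat.sub_pos_of_lt Fintype.one_lt_card)
  obtain ⟨x, hx, rfl⟩ := mem_powerFinset.1 hy
  conv_rhs => rw [← hu.card_nthRootsFinset]
  refine Finset.card_bij' (fun z _ => z / x) (fun z _ => z * x) ?_ ?_ ?_ ?_
  · intro z hz
    rw [Polynomial.mem_nthRootsFinset hk0, div_pow]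
    rw [(Finset.mem_filter.1 hz).2, div_self (pow_ne_zero _ hx)]
  · intro z hz
    rw [Polynomial.mem_nthRootsFinset hk0] at hz
    have hz0 : z ≠ 0 := by
      rintro rfl
      rw [zero_pow hk0.ne'] at hz
      exact zero_ne_one hz
    simp [hz0, hx, mul_pow, hz]
  · intro z _
    exact div_mul_cancel₀ _ hx
  · intro z _
    exact mul_div_cancel_right₀ _ hx

theorem sum_pow_eq_mul_sum_powerFinset {R : Type*} [Semiring R] {k : ℕ}
    (hk : k ∣ Fintype.card F - 1) (f : F → R) :
    ∑ x ∈ Finset.univ.erase (0 : F), f (x ^ k) = k * ∑ y ∈ powerFinset F k, f y := by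
  rw [Finset.sum_comp f (fun x => x ^ k), Finset.mul_sum]
  refine Finset.sum_congr rfl fun y hy => ?_
  rw [card_filter_pow_eq hk hy, nsmul_eq_mul]

theorem mul_card_powerFinset {k : ℕ} (hk : k ∣ Fintype.card F - 1) :
    k * (powerFinset F k).card = Fintype.card F - 1 := by
  have := sum_pow_eq_mul_sum_powerFinset (F := F) hk (fun _ => (1 : ℕ))
  simpa [Finset.card_erase_of_mem] using this.symm

theorem sum_erase_zero_mul_left {R : Type*} [AddCommMonoid R] (f : F → R) {c : F} (hc : c ≠ 0) :
    ∑ x ∈ Finset.univ.erase (0 : F), f (c * x) = ∑ x ∈ Finset.univ.erase (0 : F), f x := by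
  refine Finset.sum_bij' (fun x _ => c * x) (fun x _ => c⁻¹ * x) ?_ ?_ ?_ ?_ ?_
  · intro x hx
    simpa [hc] using hx
  · intro x hx
    simpa [hc] using hx
  · intro x _
    simp [hc]
  · intro x _
    simp [hc]
  · intro x _
    rfl

/-- Averaging a sum over `k`-th powers over the cosets of the `k * u`-th powers. -/
theorem sum_sum_pow_mul {R : Type*} [Semiring R] (k u : ℕ) (f : F → R) :
    ∑ w ∈ Finset.univ.erase (0 : F), ∑ x ∈ Finset.univ.erase (0 : F), f (w ^ k * x ^ (k * u))
      = ((Fintype.card F - 1 : ℕ) : R) * ∑ x ∈ Finset.univ.erase (0 : F), f (x ^ k) := by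
  rw [Finset.sum_comm]
  have (x : F) (hx : x ∈ Finset.univ.erase (0 : F)) :
      ∑ w ∈ Finset.univ.erase (0 : F), f (w ^ k * x ^ (k * u))
        = ∑ w ∈ Finset.univ.erase (0 : F), f (w ^ k) := by
    have hx0 : x ≠ 0 := Finset.ne_of_mem_erase hx
    -- For fixed `x`, the factor `x ^ (k * u)` is absorbed by the substitution replacing `w` by `x ^
    -- u * w`.
    rw [← sum_erase_zero_mul_left (fun w => f (w ^ k)) (pow_ne_zero u hx0)]
    refine Finset.sum_congr rfl fun w _ => ?_
    rw [mul_pow, ← pow_mul, mul_comm u k, mul_comm]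
  rw [Finset.sum_congr rfl this, Finset.sum_const, nsmul_eq_mul,
    Finset.card_erase_of_mem (Finset.mem_univ _), Finset.card_univ]

end PowerSums

/-! ### Additive characters: Fourier inversion, integrality, Frobenius invariance. -/

section CharacterSums

variable {F : Type*} [Field F] [Fintype F]

/-- A set with two nontrivial character values is a partial difference set. -/
theorem card_mul_card_filter_sub_mem [DecidableEq F] {ψ : AddChar F ℂ} (hψ : ψ.IsPrimitive)
    (R : Finset F) {f g : ℂ}
    (hfg : ∀ b : F, b ≠ 0 → ∑ x ∈ R, ψ (b * x) = f ∨ ∑ x ∈ R, ψ (b * x) = g) {a : F}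
    (ha : a ≠ 0) :
    (Fintype.card F : ℂ) * (R.filter (fun x => a - x ∈ R)).card =
      (R.card : ℂ) ^ 2 + (f + g) * ((if a ∈ R then (Fintype.card F : ℂ) else 0) - R.card)
        + f * g := by
  set η : F → ℂ := fun b => ∑ x ∈ R, ψ (b * x) with hη
  have h0 : η 0 = R.card := by simp [hη]
  have hlin (c : F) : ∑ b, ψ (b * c) = if c = 0 then (Fintype.card F : ℂ) else 0 := by
    simpa using AddChar.sum_mulShift c hψ
  have s1 : ∑ b, ψ (b * (-a)) = 0 := by
    rw [hlin, if_neg (neg_ne_zero.2 ha)]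
  have s2 : ∑ b, η b * ψ (b * (-a)) = if a ∈ R then (Fintype.card F : ℂ) else 0 := by
    simp only [hη, Finset.sum_mul, ← AddChar.map_add_eq_mul, ← mul_add]
    rw [Finset.sum_comm]
    simp only [hlin, add_neg_eq_zero]
    rw [Finset.sum_ite_eq']
  have s3 : ∑ b, η b ^ 2 * ψ (b * (-a)) =
      (Fintype.card F : ℂ) * (R.filter (fun x => a - x ∈ R)).card := by
    simp only [hη, pow_two, Finset.sum_mul, Finset.mul_sum, ← AddChar.map_add_eq_mul,
      ← mul_add]
    rw [Finset.sum_comm]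
    have (x : F) : ∑ b, ∑ y ∈ R, ψ (b * (y + x + -a)) =
        if a - x ∈ R then (Fintype.card F : ℂ) else 0 := by
      rw [Finset.sum_comm]
      simp only [hlin]
      rw [← Finset.sum_ite_eq' R (a - x) (fun _ => (Fintype.card F : ℂ))]
      refine Finset.sum_congr rfl fun y _ => if_congr ?_ rfl rfl
      rw [eq_sub_iff_add_eq, ← sub_eq_zero (b := a)]
      constructor <;> intro h <;> linear_combination h
    rw [Finset.sum_congr rfl fun x _ => this x, ← Finset.sum_filter, Finset.sum_const,
      nsmul_eq_mul, mul_comm]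
  -- The polynomial `(η - f) (η - g)` vanishes at every `b ≠ 0`, so only the trivial character
  -- contributes. Expanding the same sum by orthogonality brings in the number of representations of
  -- `a`.
  have s4 : ∑ b, (η b ^ 2 - (f + g) * η b + f * g) * ψ (b * (-a)) =
      (R.card : ℂ) ^ 2 - (f + g) * R.card + f * g := by
    rw [Finset.sum_eq_single 0]
    · simp [h0]
    · intro b _ hb
      have : η b ^ 2 - (f + g) * η b + f * g = 0 := by
        rcases hfg b hb with h | h
        · have : η b = f := h
          rw [this]; ring
        · have : η b = g := h
          rw [this]; ring
      rw [this, zero_mul]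
    · simp
  have s5 : ∑ b, (η b ^ 2 - (f + g) * η b + f * g) * ψ (b * (-a)) =
      ∑ b, η b ^ 2 * ψ (b * (-a)) - (f + g) * ∑ b, η b * ψ (b * (-a))
        + f * g * ∑ b, ψ (b * (-a)) := by
    rw [Finset.mul_sum, Finset.mul_sum, ← Finset.sum_sub_distrib, ← Finset.sum_add_distrib]
    refine Finset.sum_congr rfl fun b _ => ?_
    ring
  rw [s4, s1, s2, s3] at s5
  linear_combination -s5

theorem AddChar.isIntegral_apply (ψ : AddChar F ℂ) (x : F) : IsIntegral ℤ (ψ x) := by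
  refine IsIntegral.of_pow (n := Fintype.card F) Fintype.card_pos ?_
  rw [← AddChar.map_nsmul_eq_pow, card_nsmul_eq_zero, AddChar.map_zero_eq_one]
  exact isIntegral_one

theorem dvd_of_eq_mul_isIntegral {m N : ℤ} {z : ℂ} (hN : N ≠ 0) (hz : IsIntegral ℤ z)
    (h : (m : ℂ) = N * z) : N ∣ m := by
  have hN' : (N : ℂ) ≠ 0 := by exact_mod_cast hN
  have hz' : z = algebraMap ℚ ℂ (m / N) := by
    rw [map_div₀]
    simp only [map_intCast]
    rw [h]
    field_simp
  rw [hz', isIntegral_algebraMap_iff (algebraMap ℚ ℂ).injective,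
    IsIntegrallyClosed.isIntegral_iff] at hz
  obtain ⟨y, hy⟩ := hz
  refine ⟨y, ?_⟩
  have : (N : ℚ) ≠ 0 := by exact_mod_cast hN
  simp only [algebraMap_int_eq, eq_intCast] at hy
  rw [eq_div_iff this] at hy
  rw [mul_comm]
  exact_mod_cast hy.symm

/-- The standard character of the prime field composed with the trace: nondegeneracy of the trace
gives primitivity, and its Galois invariance gives the second property. -/
theorem exists_isPrimitive_frobenius_invariant (F : Type*) [Field F] [Fintype F] (p : ℕ)
    [Fact p.Prime] [CharP F p] :
    ∃ ψ : AddChar F ℂ, ψ.IsPrimitive ∧ ∀ x, ψ (x ^ p) = ψ x := by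
  have hp : ringChar F = p := ringChar.eq F p
  subst hp
  let : Algebra (ZMod (ringChar F)) F := ZMod.algebra F (ringChar F)
  refine ⟨(ZMod.stdAddChar (N := ringChar F)).compAddMonoidHom
    (Algebra.trace (ZMod (ringChar F)) F).toAddMonoidHom, ?_, fun x => ?_⟩
  · refine AddChar.IsPrimitive.of_ne_one (AddChar.ne_one_iff.2 ?_)
    obtain ⟨b, hb⟩ := FiniteField.trace_to_zmod_nondegenerate F one_ne_zero
    refine ⟨1 * b, fun h => hb ?_⟩
    apply ZMod.injective_stdAddChar
    rw [AddChar.map_zero_eq_one]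
    exact h
  · have := Algebra.trace_eq_of_algEquiv
      (FiniteField.frobeniusAlgEquivOfAlgebraic (ZMod (ringChar F)) F) x
    simp only [FiniteField.coe_frobeniusAlgEquivOfAlgebraic, ZMod.card] at this
    simp only [AddChar.compAddMonoidHom_apply, LinearMap.toAddMonoidHom_coe, this]

end CharacterSums

/-! ### Evaluation of the Weil sums with exponent `p ^ t + 1`, and the Gaussian periods. -/

section WeilSum

variable {F : Type*} [Field F] {p t s : ℕ} {ψ : AddChar F ℂ}

theorem AddChar.map_pow_prime_pow (hψp : ∀ x, ψ (x ^ p) = ψ x) (t : ℕ) (x : F) :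
    ψ (x ^ p ^ t) = ψ x := by
  induction t with
  | zero => simp
  | succ t ih => rw [pow_succ, pow_mul, hψp, ih]

theorem even_prime_pow_sub_one_or_neg_one_eq_one [Fact p.Prime] [CharP F p] :
    Even (p ^ t - 1) ∨ (-1 : F) = 1 := by
  rcases (Fact.out : p.Prime).eq_two_or_odd' with rfl | hp
  · right
    exact CharTwo.neg_eq 1
  · left
    exact Nat.Odd.sub_odd (hp.pow) odd_one

theorem exists_card_sub_one_eq {F : Type*} [Fintype F] (hF : Fintype.card F = p ^ (2 * t * s)) :
    ∃ M, Fintype.card F - 1 = (p ^ t + 1) * ((p ^ t - 1) * M) := by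
  obtain ⟨M, hM⟩ : (p ^ t) ^ 2 - 1 ∣ Fintype.card F - 1 := by
    rw [hF, ← pow_mul]
    exact Nat.pow_sub_one_dvd_pow_sub_one p ⟨s, by ring⟩
  refine ⟨M, ?_⟩
  rw [hM, ← mul_assoc, ← Nat.sq_sub_sq, one_pow]

/-- The radical of the quadratic form attached to `x ↦ ψ (a * x ^ (Q + 1))`, `Q = p ^ t`. -/
def hermitianKernel (p t : ℕ) (a : F) : Set F :=
  {z | a * z + a ^ p ^ t * z ^ (p ^ t) ^ 2 = 0}

theorem mul_mem_hermitianKernel {a e z : F} (he : e ^ (p ^ t) ^ 2 = e)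
    (hz : z ∈ hermitianKernel p t a) : e * z ∈ hermitianKernel p t a := by
  have h : a * z + a ^ p ^ t * z ^ (p ^ t) ^ 2 = 0 := hz
  change a * (e * z) + a ^ p ^ t * (e * z) ^ (p ^ t) ^ 2 = 0
  rw [mul_pow, he]
  linear_combination e * h

theorem mem_hermitianKernel_iff {a z : F} (hz : z ≠ 0) :
    z ∈ hermitianKernel p t a ↔ (a * z ^ (p ^ t + 1)) ^ p ^ t = -(a * z ^ (p ^ t + 1)) := by
  have h1 : (a * z ^ (p ^ t + 1)) ^ p ^ t + a * z ^ (p ^ t + 1) =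
      z ^ p ^ t * (a * z + a ^ p ^ t * z ^ (p ^ t) ^ 2) := by
    rw [mul_pow, ← pow_mul]
    ring
  rw [← add_eq_zero_iff_eq_neg, h1, mul_eq_zero, or_iff_right (pow_ne_zero _ hz)]
  rfl

theorem sum_univ_map_mul_pow_eq [Fintype F] [DecidableEq F] (ψ : AddChar F ℂ) (a : F) {N : ℕ} (hN : N ≠ 0) :
    ∑ x, ψ (a * x ^ N) = 1 + ∑ x ∈ Finset.univ.erase (0 : F), ψ (a * x ^ N) := by
  rw [← Finset.add_sum_erase _ _ (Finset.mem_univ (0 : F))]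
  simp [zero_pow hN]

section

variable [Fintype F] [Fact p.Prime]

/-- The ratio `b₀ / b` has order dividing `Q - 1`, where `Q = p ^ t`. Since `Q ^ 2 - 1` divides `q -
1`, such an element is a `(Q + 1)`-th power. -/
theorem exists_mul_pow_eq_of_pow_eq_neg_self (ht : 0 < t) (hF : Fintype.card F = p ^ (2 * t * s)) {b₀ b : F}
    (hb₀ : b₀ ≠ 0) (hb₀' : b₀ ^ p ^ t = -b₀) (hb : b ≠ 0) (hb' : b ^ p ^ t = -b) :
    ∃ y : F, y ≠ 0 ∧ b * y ^ (p ^ t + 1) = b₀ := by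
  obtain ⟨M, hM⟩ := exists_card_sub_one_eq hF
  have hQ : 1 < p ^ t := Nat.one_lt_pow ht.ne' (Fact.out : p.Prime).one_lt
  have h1 : (b₀ / b) ^ (p ^ t - 1) = 1 := by
    have h2 : (b₀ / b) ^ (p ^ t - 1) * (b₀ / b) = b₀ / b := by
      rw [← pow_succ, Nat.sub_add_cancel hQ.le, div_pow, hb₀', hb', neg_div_neg_eq]
    exact mul_right_cancel₀ (div_ne_zero hb₀ hb) (by rw [h2, one_mul])
  obtain ⟨y, hy, hy1⟩ := exists_pow_eq_of_pow_eq_one hM (c := b₀ / b) (by rw [pow_mul, h1, one_pow])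
  exact ⟨y, hy, by rw [hy1]; field_simp⟩

theorem ncard_pow_eq_self (ht : 0 < t) (hF : Fintype.card F = p ^ (2 * t * s)) :
    {e : F | e ^ (p ^ t) ^ 2 = e}.ncard = (p ^ t) ^ 2 := by
  classical
  obtain ⟨M, hM⟩ := exists_card_sub_one_eq hF
  have hQ : 1 < (p ^ t) ^ 2 :=
    Nat.one_lt_pow two_ne_zero (Nat.one_lt_pow ht.ne' (Fact.out : p.Prime).one_lt)
  obtain ⟨u, hu⟩ := exists_isPrimitiveRoot_of_dvd (F := F) (N := (p ^ t) ^ 2 - 1)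
    ⟨M, by rw [hM, ← mul_assoc, ← Nat.sq_sub_sq, one_pow]⟩
  have hpos : 0 < (p ^ t) ^ 2 - 1 := by omega
  have : {e : F | e ^ (p ^ t) ^ 2 = e} =
      insert 0 (Polynomial.nthRootsFinset ((p ^ t) ^ 2 - 1) (1 : F) : Set F) := by
    ext e
    simp only [Set.mem_ofPred_eq, Set.mem_insert_iff, Finset.mem_coe,
      Polynomial.mem_nthRootsFinset hpos]
    have h1 : e ^ (p ^ t) ^ 2 = e ^ ((p ^ t) ^ 2 - 1) * e := by
      rw [← pow_succ, Nat.sub_add_cancel hQ.le]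
    rw [h1]
    by_cases he : e = 0
    · simp [he]
    · simp [he]
  rw [this, Set.ncard_insert_of_notMem, Set.ncard_coe_finset, hu.card_nthRootsFinset]
  · omega
  · rw [Finset.mem_coe, Polynomial.mem_nthRootsFinset hpos, zero_pow hpos.ne']
    exact zero_ne_one

/-- A nonzero element `z` of the kernel makes `a * z ^ (Q + 1)` a solution of `b ^ Q = -b`, and all
nonzero solutions agree up to `(Q + 1)`-th powers. When such a `z` exists, the kernel is the line it
spans over the subfield of order `Q ^ 2`. -/
theorem ncard_hermitianKernel (ht : 0 < t) (hF : Fintype.card F = p ^ (2 * t * s)) {b₀ a : F}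
    (hb₀ : b₀ ≠ 0) (hb₀' : b₀ ^ p ^ t = -b₀) (ha : a ≠ 0) :
    ((∃ y : F, y ≠ 0 ∧ a * y ^ (p ^ t + 1) = b₀) ∧
        (hermitianKernel p t a).ncard = (p ^ t) ^ 2) ∨
      ((¬ ∃ y : F, y ≠ 0 ∧ a * y ^ (p ^ t + 1) = b₀) ∧ (hermitianKernel p t a).ncard = 1) := by
  have hQ : 0 < (p ^ t) ^ 2 := by have := (Fact.out : p.Prime).pos; positivity
  have h0 : (0 : F) ∈ hermitianKernel p t a := by
    simp [hermitianKernel, zero_pow hQ.ne']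
  by_cases h : ∃ y : F, y ≠ 0 ∧ a * y ^ (p ^ t + 1) = b₀
  · left
    refine ⟨h, ?_⟩
    obtain ⟨z, hz, hzb⟩ := h
    have hzk : z ∈ hermitianKernel p t a := by
      rw [mem_hermitianKernel_iff hz, hzb, hb₀']
    rw [← ncard_pow_eq_self (F := F) ht hF]
    symm
    refine Set.ncard_congr (fun e _ => e * z) (fun e he => mul_mem_hermitianKernel he hzk) ?_ ?_
    · intro e e' _ _ hee
      exact mul_right_cancel₀ hz hee
    · intro w hw
      refine ⟨w / z, ?_, div_mul_cancel₀ _ hz⟩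
      have h1 : a * z + a ^ p ^ t * z ^ (p ^ t) ^ 2 = 0 := hzk
      have h2 : a * w + a ^ p ^ t * w ^ (p ^ t) ^ 2 = 0 := hw
      have h3 : a ^ p ^ t * (w ^ (p ^ t) ^ 2 * z) = a ^ p ^ t * (w * z ^ (p ^ t) ^ 2) := by
        linear_combination z * h2 - w * h1
      have h4 := mul_left_cancel₀ (pow_ne_zero _ ha) h3
      change (w / z) ^ (p ^ t) ^ 2 = w / z
      rw [div_pow, div_eq_div_iff (pow_ne_zero _ hz) hz, h4]
  · right
    refine ⟨h, ?_⟩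
    rw [Set.ncard_eq_one]
    refine ⟨0, ?_⟩
    ext z
    simp only [Set.mem_singleton_iff]
    refine ⟨fun hz => ?_, fun hz => hz ▸ h0⟩
    by_contra hz0
    rw [mem_hermitianKernel_iff hz0] at hz
    obtain ⟨y, hy, hyb⟩ := exists_mul_pow_eq_of_pow_eq_neg_self ht hF hb₀ hb₀'
      (mul_ne_zero ha (pow_ne_zero _ hz0)) hz
    exact h ⟨z * y, mul_ne_zero hz0 hy, by rw [mul_pow, ← mul_assoc, hyb]⟩

end

variable [Fact p.Prime] [CharP F p]

theorem neg_one_pow_eq_one_of_prime_pow_sub_one {M : ℕ} :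
    (-1 : F) ^ ((p ^ t - 1) * M) = 1 := by
  rcases even_prime_pow_sub_one_or_neg_one_eq_one (F := F) (p := p) (t := t) with h | h
  · exact (h.mul_right M).neg_one_pow
  · rw [h, one_pow]

theorem map_mul_add_pow (hψp : ∀ x, ψ (x ^ p) = ψ x) (a y z : F) :
    ψ (a * (y + z) ^ (p ^ t + 1)) = ψ (a * y ^ (p ^ t + 1)) * ψ (a * z ^ (p ^ t + 1)) *
      ψ (y ^ p ^ t * (a * z + a ^ p ^ t * z ^ (p ^ t) ^ 2)) := by
  have h1 : a * (y + z) ^ (p ^ t + 1) =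
      a * y ^ (p ^ t + 1) + a * z ^ (p ^ t + 1) + y ^ p ^ t * (a * z) + a * y * z ^ p ^ t := by
    rw [pow_succ, add_pow_expChar_pow]
    ring
  -- Frobenius invariance allows the argument to be raised to the power `Q`, so both cross terms
  -- become multiples of `y ^ Q`.
  have h2 : ψ (a * y * z ^ p ^ t) = ψ (y ^ p ^ t * (a ^ p ^ t * z ^ (p ^ t) ^ 2)) := by
    rw [← AddChar.map_pow_prime_pow hψp t (a * y * z ^ p ^ t)]
    congr 1
    rw [mul_pow, mul_pow, ← pow_mul, pow_two]
    ring
  rw [h1, AddChar.map_add_eq_mul, AddChar.map_add_eq_mul, AddChar.map_add_eq_mul, h2, mul_add,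
    AddChar.map_add_eq_mul, mul_assoc, mul_assoc]

variable [Fintype F]

theorem exists_pow_eq_neg_one (hF : Fintype.card F = p ^ (2 * t * s)) :
    ∃ c : F, c ≠ 0 ∧ c ^ (p ^ t + 1) = -1 := by
  obtain ⟨M, hM⟩ := exists_card_sub_one_eq hF
  exact exists_pow_eq_of_pow_eq_one hM neg_one_pow_eq_one_of_prime_pow_sub_one

theorem exists_pow_eq_neg_self (ht : 0 < t) (hF : Fintype.card F = p ^ (2 * t * s)) :
    ∃ b : F, b ≠ 0 ∧ b ^ p ^ t = -b := by
  obtain ⟨M, hM⟩ := exists_card_sub_one_eq hF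
  have hQ : 1 < p ^ t := Nat.one_lt_pow ht.ne' (Fact.out : p.Prime).one_lt
  have hM' : Fintype.card F - 1 = (p ^ t - 1) * ((p ^ t + 1) * M) := by rw [hM]; ring
  have h1 : (-1 : F) ^ ((p ^ t + 1) * M) = 1 := by
    rcases even_prime_pow_sub_one_or_neg_one_eq_one (F := F) (p := p) (t := t) with h | h
    · have : Even (p ^ t + 1) := by
        obtain ⟨j, hj⟩ := h
        exact ⟨j + 1, by omega⟩
      exact (this.mul_right M).neg_one_pow
    · rw [h, one_pow]
  obtain ⟨b, hb, hb1⟩ := exists_pow_eq_of_pow_eq_one hM' h1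
  refine ⟨b, hb, ?_⟩
  calc b ^ p ^ t = b ^ (p ^ t - 1) * b := by rw [← pow_succ, Nat.sub_add_cancel hQ.le]
    _ = -b := by rw [hb1]; ring

/-- Choose a `(Q + 1)`-th root of unity `u ≠ 1` and `c` in the kernel with `u * c = z + c`. The
value at `u * c` equals the value at `c`, while additivity on the kernel makes it the product of the
values at `z` and `c`. This covers characteristic two as well. -/
theorem map_mul_pow_eq_one (ht : 0 < t) (hF : Fintype.card F = p ^ (2 * t * s))
    (hψp : ∀ x, ψ (x ^ p) = ψ x) {a z : F} (hz : z ∈ hermitianKernel p t a) :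
    ψ (a * z ^ (p ^ t + 1)) = 1 := by
  obtain ⟨M, hM⟩ := exists_card_sub_one_eq hF
  have hQ : 1 < p ^ t := Nat.one_lt_pow ht.ne' (Fact.out : p.Prime).one_lt
  obtain ⟨u, hu⟩ := exists_isPrimitiveRoot_of_dvd (F := F) ⟨_, hM⟩
  have hu1 : u ≠ 1 := hu.ne_one (by omega)
  have hu2 : u ^ (p ^ t) ^ 2 = u := by
    obtain ⟨j, hj⟩ := Nat.exists_eq_add_of_lt hQ
    have : (p ^ t) ^ 2 = (p ^ t + 1) * (p ^ t - 1) + 1 := by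
      rw [hj]
      simp only [Nat.add_sub_cancel]
      ring
    rw [this, pow_succ, pow_mul, hu.pow_eq_one, one_pow, one_mul]
  set c := (u - 1)⁻¹ * z with hc
  have hcz : u * c = z + c := by
    have : u - 1 ≠ 0 := sub_ne_zero.2 hu1
    rw [hc]
    field_simp
    ring
  have hv : ((u - 1)⁻¹) ^ (p ^ t) ^ 2 = (u - 1)⁻¹ := by
    rw [inv_pow, ← pow_mul, sub_pow_char_pow, one_pow, pow_mul, hu2]
  have hck : c ∈ hermitianKernel p t a := mul_mem_hermitianKernel hv hz
  have h1 := map_mul_add_pow (t := t) hψp a z c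
  have h2 : a * c + a ^ p ^ t * c ^ (p ^ t) ^ 2 = 0 := hck
  rw [← hcz, mul_pow, hu.pow_eq_one, one_mul, h2, mul_zero, AddChar.map_zero_eq_one, mul_one] at h1
  have h3 : ψ (a * c ^ (p ^ t + 1)) ≠ 0 := (AddChar.val_isUnit ψ _).ne_zero
  exact mul_right_cancel₀ h3 (by rw [← h1, one_mul])

theorem pow_prime_pow_bijective (p t : ℕ) [Fact p.Prime] [CharP F p] :
    Function.Bijective (fun x : F => x ^ p ^ t) := by
  rw [← Finite.injective_iff_bijective]
  intro x y hxy
  have : (x - y) ^ p ^ t = 0 := by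
    rw [sub_pow_char_pow]
    exact sub_eq_zero.2 hxy
  exact sub_eq_zero.1 (eq_zero_of_pow_eq_zero this)

theorem weilSum_sq (ht : 0 < t) (hF : Fintype.card F = p ^ (2 * t * s)) (hψ : ψ.IsPrimitive)
    (hψp : ∀ x, ψ (x ^ p) = ψ x) (a : F) :
    (∑ x, ψ (a * x ^ (p ^ t + 1))) ^ 2 = Fintype.card F * (hermitianKernel p t a).ncard := by
  classical
  obtain ⟨c, hc, hc1⟩ := exists_pow_eq_neg_one hF
  -- As `-1` is a `(Q + 1)`-th power, the sum equals its conjugate; its square can then be expanded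
  -- like a squared modulus.
  have hneg : ∑ x, ψ (a * x ^ (p ^ t + 1)) = ∑ x, ψ (-(a * x ^ (p ^ t + 1))) := by
    rw [← (mulLeft_bijective₀ c hc).sum_comp]
    refine Finset.sum_congr rfl fun x _ => ?_
    rw [mul_pow, hc1]
    congr 1
    ring
  have hinner (z : F) : ∑ y, ψ (y ^ p ^ t * (a * z + a ^ p ^ t * z ^ (p ^ t) ^ 2)) =
      if z ∈ hermitianKernel p t a then (Fintype.card F : ℂ) else 0 := by
    have := (pow_prime_pow_bijective (F := F) p t).sum_comp
      (fun y => ψ (y * (a * z + a ^ p ^ t * z ^ (p ^ t) ^ 2)))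
    rw [this, AddChar.sum_mulShift _ hψ]
    simp only [hermitianKernel, Set.mem_ofPred_eq]
    push_cast
    rfl
  rw [pow_two]
  nth_rw 2 [hneg]
  rw [mul_comm, Finset.sum_mul_sum]
  have hshift (y : F) : ∑ x, ψ (-(a * y ^ (p ^ t + 1))) * ψ (a * x ^ (p ^ t + 1)) =
      ∑ z, ψ (a * z ^ (p ^ t + 1)) *
        ψ (y ^ p ^ t * (a * z + a ^ p ^ t * z ^ (p ^ t) ^ 2)) := by
    rw [← Equiv.sum_comp (Equiv.addLeft y)]
    refine Finset.sum_congr rfl fun z _ => ?_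
    rw [Equiv.coe_addLeft, map_mul_add_pow hψp, AddChar.map_neg_eq_inv]
    have : ψ (a * y ^ (p ^ t + 1)) ≠ 0 := (AddChar.val_isUnit ψ _).ne_zero
    field_simp
  rw [Finset.sum_congr rfl fun y _ => hshift y, Finset.sum_comm]
  simp only [← Finset.mul_sum, hinner]
  have hz (z : F) : (ψ (a * z ^ (p ^ t + 1)) *
      if z ∈ hermitianKernel p t a then (Fintype.card F : ℂ) else 0) =
      if z ∈ hermitianKernel p t a then (Fintype.card F : ℂ) else 0 := by
    split_ifs with h
    · rw [map_mul_pow_eq_one ht hF hψp h, one_mul]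
    · rw [mul_zero]
  rw [Finset.sum_congr rfl fun z _ => hz z, ← Finset.sum_filter, Finset.sum_const, nsmul_eq_mul,
    mul_comm, Set.ncard_eq_toFinset_card']
  congr 3
  ext z
  simp

theorem weilSum_eq [DecidableEq F] (ht : 0 < t) (hF : Fintype.card F = p ^ (2 * t * s))
    (hψ : ψ.IsPrimitive) (hψp : ∀ x, ψ (x ^ p) = ψ x) {b₀ a : F}
    (hb₀ : b₀ ≠ 0) (hb₀' : b₀ ^ p ^ t = -b₀) (ha : a ≠ 0) {ρ : ℤ}
    (hρ : ρ = -(-(p : ℤ) ^ t) ^ s) :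
    ∑ x, ψ (a * x ^ (p ^ t + 1)) =
      -ρ + ρ * if ∃ y : F, y ≠ 0 ∧ a * y ^ (p ^ t + 1) = b₀ then ((p ^ t + 1 : ℕ) : ℂ) else 0 := by
  obtain ⟨M, hM⟩ := exists_card_sub_one_eq hF
  have hQ : 1 < p ^ t := Nat.one_lt_pow ht.ne' (Fact.out : p.Prime).one_lt
  -- The nonzero `x` contribute `Q + 1` times an algebraic integer. With `ρ ≡ -1` modulo `Q + 1`,
  -- the wrong sign of the square root would force `Q + 1 ∣ 2`.
  have hmod (m : ℤ) (hm : (∑ x, ψ (a * x ^ (p ^ t + 1))) = m) : ((p : ℤ) ^ t + 1) ∣ m - 1 := by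
    have h1 := sum_univ_map_mul_pow_eq ψ a (N := p ^ t + 1) (by omega)
    rw [hm, sum_pow_eq_mul_sum_powerFinset ⟨_, hM⟩ (fun y => ψ (a * y))] at h1
    refine dvd_of_eq_mul_isIntegral (by positivity)
      (IsIntegral.sum (s := powerFinset F (p ^ t + 1)) (fun y => ψ (a * y))
        fun y _ => ψ.isIntegral_apply (a * y)) ?_
    push_cast at h1 ⊢
    rw [h1]
    ring
  have hρ1 : ((p : ℤ) ^ t + 1) ∣ ρ + 1 := by
    have := sub_dvd_pow_sub_pow (1 : ℤ) (-(p : ℤ) ^ t) s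
    rw [one_pow, sub_neg_eq_add, add_comm] at this
    rwa [hρ, neg_add_eq_sub]
  have htwo (h : ((p : ℤ) ^ t + 1) ∣ 2) : False := by
    have h1 := Int.le_of_dvd (by norm_num) h
    have h2 : (1 : ℤ) < (p : ℤ) ^ t := by exact_mod_cast hQ
    omega
  have hcard : (Fintype.card F : ℂ) = (ρ : ℂ) ^ 2 := by
    rw [hF, hρ]
    push_cast
    rw [neg_sq, ← pow_mul, mul_comm s 2, pow_mul (-(p : ℂ) ^ t), neg_sq]
    ring
  have hsq := weilSum_sq ht hF hψ hψp a
  rcases ncard_hermitianKernel ht hF hb₀ hb₀' ha with ⟨h, hn⟩ | ⟨h, hn⟩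
  · rw [if_pos h]
    rw [hn, hcard] at hsq
    have h2 : (∑ x, ψ (a * x ^ (p ^ t + 1))) ^ 2 = ((ρ * (p : ℤ) ^ t : ℤ) : ℂ) ^ 2 := by
      rw [hsq]
      push_cast
      ring
    rcases sq_eq_sq_iff_eq_or_eq_neg.1 h2 with h3 | h3
    · rw [h3]
      push_cast
      ring
    · exfalso
      have h4 := hmod (-(ρ * (p : ℤ) ^ t)) (by rw [h3]; push_cast; ring)
      apply htwo
      have h5 := (dvd_add h4 (dvd_mul_of_dvd_left (dvd_refl ((p : ℤ) ^ t + 1)) ρ)).sub hρ1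
      have h6 : -(ρ * (p : ℤ) ^ t) - 1 + ((p : ℤ) ^ t + 1) * ρ - (ρ + 1) = -2 := by ring
      rw [h6] at h5
      exact (Int.dvd_neg).1 h5
  · rw [if_neg h]
    rw [hn, hcard, Nat.cast_one, mul_one] at hsq
    rcases sq_eq_sq_iff_eq_or_eq_neg.1 hsq with h3 | h3
    · exfalso
      apply htwo
      have := hρ1.sub (hmod ρ h3)
      have h6 : ρ + 1 - (ρ - 1) = 2 := by ring
      rwa [h6] at this
    · rw [h3]
      ring

/-- In the semiprimitive case the Gaussian periods take only two values. -/
theorem sum_powerFinset_eq_or_eq [DecidableEq F] {k : ℕ} (hk : k ∣ p ^ t + 1) (ht : 0 < t)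
    (hF : Fintype.card F = p ^ (2 * t * s)) (hψ : ψ.IsPrimitive) (hψp : ∀ x, ψ (x ^ p) = ψ x)
    {a : F} (ha : a ≠ 0) {ρ : ℤ} (hρ : ρ = -(-(p : ℤ) ^ t) ^ s) :
    ∑ y ∈ powerFinset F k, ψ (a * y) = -((ρ + 1) / k) ∨
      ∑ y ∈ powerFinset F k, ψ (a * y) = -((ρ + 1) / k) + ρ := by
  obtain ⟨M, hM⟩ := exists_card_sub_one_eq hF
  obtain ⟨b₀, hb₀, hb₀'⟩ := exists_pow_eq_neg_self ht hF
  obtain ⟨u, hu⟩ := hk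
  have hk0 : (k : ℂ) ≠ 0 := by
    rintro h
    rw [Nat.cast_eq_zero.1 h] at hu
    omega
  have hkF : k ∣ Fintype.card F - 1 := ⟨u * ((p ^ t - 1) * M), by rw [hM, hu, mul_assoc]⟩
  have hq0 : ((Fintype.card F - 1 : ℕ) : ℂ) ≠ 0 :=
    Nat.cast_ne_zero.2 (Nat.sub_pos_of_lt Fintype.one_lt_card).ne'
  have hδ (j : ℕ) (hj : j ∣ Fintype.card F - 1) (c : F) (hc : c ≠ 0) :
      ∑ x ∈ Finset.univ.erase (0 : F), (if c * x ^ j = b₀ then (1 : ℂ) else 0) =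
        if ∃ y : F, y ≠ 0 ∧ c * y ^ j = b₀ then (j : ℂ) else 0 := by
    rw [sum_pow_eq_mul_sum_powerFinset hj (fun y => if c * y = b₀ then (1 : ℂ) else 0)]
    have (y : F) : c * y = b₀ ↔ b₀ / c = y := by
      rw [div_eq_iff hc, eq_comm, mul_comm]
    simp only [this, Finset.sum_ite_eq, mem_powerFinset, mul_ite, mul_one, mul_zero]
    refine if_congr (exists_congr fun y => and_congr_right fun _ => eq_comm) rfl rfl
  -- Rewriting the case distinction of `weilSum_eq` as a sum of indicators gives an affine relation
  -- between sums over `(Q + 1)`-th powers. Averaging over `w`, with `a` replaced by `a * w ^ k`,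
  -- transfers it to `k`-th powers.
  have hT : ∑ x ∈ Finset.univ.erase (0 : F), ψ (a * x ^ k) = -ρ - 1 + ρ *
      ∑ x ∈ Finset.univ.erase (0 : F), (if a * x ^ k = b₀ then (1 : ℂ) else 0) := by
    apply mul_left_cancel₀ hq0
    rw [mul_add, mul_left_comm _ (ρ : ℂ), ← sum_sum_pow_mul k u (fun y => ψ (a * y)),
      ← sum_sum_pow_mul k u (fun y => if a * y = b₀ then (1 : ℂ) else 0)]
    have h1 (w : F) (hw : w ∈ Finset.univ.erase (0 : F)) :
        ∑ x ∈ Finset.univ.erase (0 : F), ψ (a * (w ^ k * x ^ (k * u))) = (-ρ - 1) + ρ *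
          ∑ x ∈ Finset.univ.erase (0 : F),
            (if a * (w ^ k * x ^ (k * u)) = b₀ then (1 : ℂ) else 0) := by
      have haw : a * w ^ k ≠ 0 := mul_ne_zero ha (pow_ne_zero _ (Finset.ne_of_mem_erase hw))
      simp only [← mul_assoc a, ← hu]
      rw [hδ _ ⟨_, hM⟩ _ haw]
      have h2 := weilSum_eq ht hF hψ hψp hb₀ hb₀' haw hρ
      rw [sum_univ_map_mul_pow_eq ψ _ (by omega)] at h2
      linear_combination h2
    rw [Finset.sum_congr rfl h1, Finset.sum_add_distrib, ← Finset.mul_sum, Finset.sum_const,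
      nsmul_eq_mul, Finset.card_erase_of_mem (Finset.mem_univ _), Finset.card_univ]
  rw [hδ _ hkF _ ha, sum_pow_eq_mul_sum_powerFinset hkF (fun y => ψ (a * y))] at hT
  split_ifs at hT
  · right
    apply mul_left_cancel₀ hk0
    rw [hT]
    field_simp
    ring
  · left
    apply mul_left_cancel₀ hk0
    rw [hT]
    field_simp
    ring

end WeilSum

/-! ### From integral parameters to the real-valued predicates. -/

namespace SimpleGraph

section Parameters

variable {V : Type*} [Fintype V] {G : SimpleGraph V} [DecidableRel G.Adj] {v r e d : ℕ}

theorem isSRGWith_of_ncard (hv : Fintype.card V = v) (hr : ∀ x, {z | G.Adj x z}.ncard = r)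
    (he : ∀ x y, G.Adj x y → {z | G.Adj x z ∧ G.Adj y z}.ncard = e)
    (hd : ∀ x y, x ≠ y → ¬ G.Adj x y → {z | G.Adj x z ∧ G.Adj y z}.ncard = d) :
    G.IsSRGWith v r e d where
  card := hv
  regular x := by
    rw [← G.card_neighborSet_eq_degree, ← Nat.card_eq_fintype_card]
    exact hr x
  of_adj x y hxy := by
    rw [← Nat.card_eq_fintype_card]
    exact he x y hxy
  of_not_adj x y hne hxy := by
    rw [← Nat.card_eq_fintype_card]
    exact hd x y hne hxy

theorem IsSRGWith.le_of_ne_bot (h : G.IsSRGWith v r e d) (hbot : G ≠ ⊥) : e ≤ r := by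
  obtain ⟨x, y, hxy⟩ := ne_bot_iff_exists_adj.1 hbot
  rw [← h.ncard_of_adj hxy, ← h.ncard_neighborSet x]
  exact Set.ncard_le_ncard fun z hz => hz.1

theorem IsSRGWith.le_of_ne_top (h : G.IsSRGWith v r e d) (htop : G ≠ ⊤) : d ≤ r := by
  obtain ⟨x, y, hne, hxy⟩ := ne_top_iff_exists_not_adj.1 htop
  rw [← h.ncard_of_not_adj hne hxy, ← h.ncard_neighborSet x]
  exact Set.ncard_le_ncard fun z hz => hz.1

theorem IsSRGWith.isStronglyRegular (h : G.IsSRGWith v r e d) (htop : G ≠ ⊤) (hbot : G ≠ ⊥)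
    {v' r' e' d' : ℝ} (hv : v' = v) (hr : r' = r) (he : e' = e) (hd : d' = d) :
    G.IsStronglyRegular v' r' e' d' := by
  refine ⟨htop, hbot, v, r, e, d, hv.symm, hr.symm, he.symm, hd.symm, ?_⟩
  convert! h

variable [DecidableEq V]

theorem IsSRGWith.isIntegral (h : G.IsSRGWith v r e d) {f g : ℤ} (hsum : f + g = (e : ℤ) - d)
    (hprod : f * g = (d : ℤ) - r) : G.IsIntegral := by
  intro μ hμ
  rcases h.eq_of_mem_eigenvalueSet (f := f) (g := g) (by exact_mod_cast hsum)
    (by exact_mod_cast hprod) hμ with h | h | h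
  · exact ⟨r, by rw [h]; simp⟩
  · exact ⟨f, h⟩
  · exact ⟨g, h⟩

theorem IsSRGWith.isSpectralPseudoLatinSquare (h : G.IsSRGWith v r e d) (htop : G ≠ ⊤)
    (hbot : G ≠ ⊥) {f g : ℤ} (hf : 0 < f) (hg : g < 0) (hfr : f ≠ r) (hv : (v : ℤ) = (f - g) ^ 2)
    (hr : (r : ℤ) = -g * (f - g - 1)) (he : (e : ℤ) = g ^ 2 + 3 * g + (f - g))
    (hd : (d : ℤ) = g * (g + 1)) {r' : ℝ} (hr' : r' = r) : G.IsSpectralPseudoLatinSquare r' := by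
  have hsum : f + g = (e : ℤ) - d := by rw [he, hd]; ring
  have hprod : f * g = (d : ℤ) - r := by rw [hd, hr]; ring
  have hgr : g ≠ r := by omega
  have hw : (((f - g).toNat : ℤ)) = f - g := Int.toNat_of_nonneg (by omega)
  have hδ : (((-g).toNat : ℤ)) = -g := Int.toNat_of_nonneg (by omega)
  have hw' : (((f - g).toNat : ℝ)) = f - g := by exact_mod_cast hw
  have hδ' : (((-g).toNat : ℝ)) = -g := by exact_mod_cast hδ
  refine ⟨f, g, by exact_mod_cast hf, by exact_mod_cast hg, ?_, (-g).toNat, (f - g).toNat,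
    hw', hδ', h.isStronglyRegular htop hbot ?_ ?_ ?_ ?_⟩
  · rw [hr']
    exact h.eigenvalueSet_sdiff (by exact_mod_cast hsum) (by exact_mod_cast hprod) htop
      (by exact_mod_cast hf.ne') (by exact_mod_cast hg.ne) (by exact_mod_cast hfr)
      (by exact_mod_cast hgr)
  · rw [hw']; exact_mod_cast hv.symm
  · rw [hw', hδ']; exact_mod_cast hr.symm
  · rw [hw', hδ']
    have : (e : ℝ) = g ^ 2 + 3 * g + (f - g) := by exact_mod_cast he
    rw [this]; ring
  · rw [hδ']
    have : (d : ℝ) = g * (g + 1) := by exact_mod_cast hd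
    rw [this]; ring

end Parameters

end SimpleGraph

/-! ### The generalized Paley graph as a strongly regular Cayley graph. -/

section GeneralizedPaley

variable {F : Type*} [Field F]

theorem gpGraph_adj_iff {k : ℕ} (hneg : (-1 : F) ∈ nonzeroPowers F k) {u v : F} :
    (gpGraph F k).Adj u v ↔ v - u ∈ nonzeroPowers F k := by
  have hsymm {y : F} (hy : y ∈ nonzeroPowers F k) : -y ∈ nonzeroPowers F k := by
    obtain ⟨c, hc, hc1⟩ := hneg
    obtain ⟨x, hx, rfl⟩ := hy
    exact ⟨c * x, mul_ne_zero hc hx, by rw [mul_pow, hc1]; ring⟩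
  change u ≠ v ∧ (v - u ∈ nonzeroPowers F k ∨ u - v ∈ nonzeroPowers F k) ↔ _
  constructor
  · rintro ⟨-, h | h⟩
    · exact h
    · rw [← neg_sub]
      exact hsymm h
  · intro h
    refine ⟨?_, Or.inl h⟩
    rintro rfl
    obtain ⟨x, hx, hx0⟩ := h
    rw [sub_self] at hx0
    exact pow_ne_zero _ hx hx0

variable [Fintype F]

section

variable [DecidableEq F]

theorem gpGraph_adj_iff_mem_powerFinset {k : ℕ} (hneg : (-1 : F) ∈ nonzeroPowers F k) {u v : F} :
    (gpGraph F k).Adj u v ↔ v - u ∈ powerFinset F k := by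
  rw [gpGraph_adj_iff hneg, mem_powerFinset]
  rfl

theorem neg_mem_powerFinset_iff {k : ℕ} (hneg : (-1 : F) ∈ nonzeroPowers F k) {y : F} :
    -y ∈ powerFinset F k ↔ y ∈ powerFinset F k := by
  have h1 := gpGraph_adj_iff_mem_powerFinset hneg (u := 0) (v := y)
  have h2 := gpGraph_adj_iff_mem_powerFinset hneg (u := y) (v := 0)
  rw [sub_zero] at h1
  rw [zero_sub] at h2
  rw [← h1, ← h2, SimpleGraph.adj_comm]

theorem ncard_gpGraph_adj {k : ℕ} (hneg : (-1 : F) ∈ nonzeroPowers F k) (x : F) :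
    {z | (gpGraph F k).Adj x z}.ncard = (powerFinset F k).card := by
  simp only [gpGraph_adj_iff_mem_powerFinset hneg]
  rw [← Set.ncard_coe_finset]
  refine Set.ncard_congr (fun z _ => z - x) (fun z hz => hz) ?_ ?_
  · intro z w _ _ h
    exact sub_left_injective h
  · intro y hy
    exact ⟨y + x, by simpa using hy, add_sub_cancel_right y x⟩

/-- By symmetry of the connection set, common neighbours correspond to representations of `y - x` as
a sum of two of its elements. -/
theorem ncard_gpGraph_adj_adj {k : ℕ} (hneg : (-1 : F) ∈ nonzeroPowers F k) (x y : F) :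
    {z | (gpGraph F k).Adj x z ∧ (gpGraph F k).Adj y z}.ncard =
      ((powerFinset F k).filter (fun w => (y - x) - w ∈ powerFinset F k)).card := by
  simp only [gpGraph_adj_iff_mem_powerFinset hneg]
  rw [← Set.ncard_coe_finset]
  have h (z : F) : z - y ∈ powerFinset F k ↔ (y - x) - (z - x) ∈ powerFinset F k := by
    rw [← neg_mem_powerFinset_iff hneg]
    congr! 1
    ring
  refine Set.ncard_congr (fun z _ => z - x) (fun z hz => ?_) ?_ ?_
  · rw [Finset.mem_coe, Finset.mem_filter, ← h]
    exact hz
  · intro z w _ _ h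
    exact sub_left_injective h
  · intro w hw
    rw [Finset.mem_coe, Finset.mem_filter] at hw
    refine ⟨w + x, ?_, add_sub_cancel_right w x⟩
    rw [Set.mem_ofPred_eq, h, add_sub_cancel_right]
    exact hw

end

variable {p t s k : ℕ} [Fact p.Prime] [CharP F p]

theorem neg_one_mem_nonzeroPowers (hk : k ∣ p ^ t + 1) (hF : Fintype.card F = p ^ (2 * t * s)) :
    (-1 : F) ∈ nonzeroPowers F k := by
  obtain ⟨c, hc, hc1⟩ := exists_pow_eq_neg_one (F := F) hF
  obtain ⟨u, hu⟩ := hk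
  exact ⟨c ^ u, pow_ne_zero _ hc, by rw [← pow_mul, mul_comm, ← hu, hc1]⟩

theorem gpGraph_isSRGWith [DecidableRel (gpGraph F k).Adj] (hk : k ∣ p ^ t + 1) (ht : 0 < t)
    (hF : Fintype.card F = p ^ (2 * t * s)) {ρ l : ℤ} (hρ : ρ = -(-(p : ℤ) ^ t) ^ s)
    (hl : k * l = -(ρ + 1)) (hl0 : l ≠ 0) :
    ∃ n e d : ℕ, (n : ℤ) = (1 - ρ) * l ∧ (d : ℤ) = l * (l + 1) ∧
      (e : ℤ) = l * (l + 1) + ρ + 2 * l ∧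
      (gpGraph F k).IsSRGWith (Fintype.card F) n e d := by
  classical
  have hneg := neg_one_mem_nonzeroPowers (F := F) hk hF
  obtain ⟨M, hM⟩ := exists_card_sub_one_eq hF
  have hkF : k ∣ Fintype.card F - 1 := hk.trans ⟨_, hM⟩
  have hk0 : (k : ℤ) ≠ 0 := by
    rintro h
    rw [Nat.cast_eq_zero.1 h] at hk
    exact absurd (Nat.eq_zero_of_zero_dvd hk) (by omega)
  have hcard : (Fintype.card F : ℤ) = ρ ^ 2 := by
    rw [hF, hρ]
    push_cast
    rw [neg_sq, ← pow_mul, mul_comm s 2, pow_mul (-(p : ℤ) ^ t), neg_sq]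
    ring
  have hρ0 : ρ ^ 2 ≠ 0 := by
    rw [← hcard]
    exact_mod_cast Fintype.card_ne_zero
  have hn : ((powerFinset F k).card : ℤ) = (1 - ρ) * l := by
    have h1 := mul_card_powerFinset hkF
    have h2 : (k : ℤ) * (powerFinset F k).card = Fintype.card F - 1 := by
      have : 1 ≤ Fintype.card F := Fintype.card_pos
      zify [this] at h1
      exact h1
    apply mul_left_cancel₀ hk0
    rw [h2, hcard]
    linear_combination (ρ - 1) * hl
  obtain ⟨ψ, hψ, hψp⟩ := exists_isPrimitive_frobenius_invariant F p
  have hlC : -(((ρ : ℂ) + 1) / k) = l := by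
    have hkC : (k : ℂ) ≠ 0 := by exact_mod_cast hk0
    have : (k : ℂ) * l = -(ρ + 1) := by exact_mod_cast hl
    field_simp
    linear_combination -this
  have hC (a : F) (ha : a ≠ 0) :
      (((powerFinset F k).filter (fun w => a - w ∈ powerFinset F k)).card : ℤ) =
        l * (l + 1) + if a ∈ powerFinset F k then ρ + 2 * l else 0 := by
    have h1 := card_mul_card_filter_sub_mem hψ (powerFinset F k)
      (fun b hb => sum_powerFinset_eq_or_eq hk ht hF hψ hψp hb hρ) ha
    rw [hlC] at h1
    have h2 : (Fintype.card F : ℤ) *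
        ((powerFinset F k).filter (fun w => a - w ∈ powerFinset F k)).card =
        ((powerFinset F k).card : ℤ) ^ 2 + (l + (l + ρ)) *
          ((if a ∈ powerFinset F k then (Fintype.card F : ℤ) else 0) - (powerFinset F k).card)
        + l * (l + ρ) := by
      exact_mod_cast h1
    apply mul_left_cancel₀ hρ0
    rw [hn, hcard] at h2
    rw [h2]
    split_ifs <;> ring
  have hd : 0 ≤ l * (l + 1) := by
    rcases lt_or_gt_of_ne hl0 with h | h
    · nlinarith
    · positivity
  have he : 0 ≤ l * (l + 1) + ρ + 2 * l := by
    have h1 := hC 1 one_ne_zero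
    rw [if_pos (mem_powerFinset.2 ⟨1, one_ne_zero, one_pow k⟩), ← add_assoc] at h1
    rw [← h1]
    positivity
  refine ⟨(powerFinset F k).card, (l * (l + 1) + ρ + 2 * l).toNat, (l * (l + 1)).toNat, hn,
    Int.toNat_of_nonneg hd, Int.toNat_of_nonneg he,
    SimpleGraph.isSRGWith_of_ncard rfl (ncard_gpGraph_adj hneg) (fun x y hxy => ?_)
      (fun x y hne hxy => ?_)⟩
  · rw [ncard_gpGraph_adj_adj hneg]
    have h1 := hC (y - x) (sub_ne_zero.2 hxy.ne')
    rw [gpGraph_adj_iff_mem_powerFinset hneg] at hxy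
    rw [if_pos hxy] at h1
    omega
  · rw [ncard_gpGraph_adj_adj hneg]
    have h1 := hC (y - x) (sub_ne_zero.2 hne.symm)
    rw [gpGraph_adj_iff_mem_powerFinset hneg] at hxy
    rw [if_neg hxy] at h1
    omega

end GeneralizedPaley

theorem theorem5p4 (F : Type*) [Field F] [Fintype F] (k p m t s : ℕ)
    (hF : Fintype.card F = p ^ m)
    (hk : IsSemiprimitivePair k p m)
    (ht : IsLeast {j : ℕ | 0 < j ∧ k ∣ p ^ j + 1} t)
    (hm : m = 2 * t * s)
    (q n σ l₂ e d e' d' : ℝ)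
    (hq : q = (p : ℝ) ^ m)
    (hn : n = (q - 1) / k)
    (hσ : σ = (-1) ^ (s + 1))
    (hl₂ : l₂ = -((σ * (p : ℝ) ^ (m / 2) + 1) / k))
    (hd : d = n + (σ * (p : ℝ) ^ (m / 2) + l₂) * l₂)
    (he : e = d + (σ * (p : ℝ) ^ (m / 2) + 2 * l₂))
    (he' : e' = q - 2 - 2 * n + d)
    (hd' : d' = q - 2 * n + e) :
    -- the digraph is undirected, so that `gpGraph F k` is the generalized Paley graph itself
    (∀ u v : F, (gpGraph F k).Adj u v ↔ (gpDigraph F k).Adj u v) ∧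
    -- (a)
    ((gpGraph F k).IsStronglyRegular q n e d ∧
      (gpGraph F k).IsPrimitive ∧ ¬ (gpGraph F k).IsBipartite ∧ (gpGraph F k).IsIntegral) ∧
    ((gpGraph F k)ᶜ.IsStronglyRegular q ((k - 1) * n) e' d' ∧
      (gpGraph F k)ᶜ.IsPrimitive ∧ ¬ (gpGraph F k)ᶜ.IsBipartite ∧ (gpGraph F k)ᶜ.IsIntegral) ∧
    -- (b)
    ((gpGraph F k).IsDistanceRegular ∧ (gpGraph F k).diam = 2 ∧
      (gpGraph F k).HasIntersectionArray ![n, n - e - 1] ![1, d]) ∧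
    ((gpGraph F k)ᶜ.IsDistanceRegular ∧ (gpGraph F k)ᶜ.diam = 2 ∧
      (gpGraph F k)ᶜ.HasIntersectionArray ![(k - 1) * n, n - d] ![1, q - 2 * n + e]) ∧
    -- (c)
    (Odd s →
      (gpGraph F k).IsSpectralPseudoLatinSquare n ∧
      (gpGraph F k)ᶜ.IsSpectralPseudoLatinSquare ((k - 1) * n)) := by
  classical
  obtain ⟨hp, hm0, hsemi⟩ := hk
  obtain ⟨ht0, hkt⟩ := ht.1
  have : Fact p.Prime := ⟨hp⟩
  have : CharP F p := charP_of_card_eq_prime_pow hF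
  have hk2 : 2 ≤ k := by
    rcases hsemi with h | h
    · exact h.1.ge
    · exact h.1.le
  have hF' : Fintype.card F = p ^ (2 * t * s) := by rw [hF, hm]
  have hm2 : m / 2 = t * s := by rw [hm, mul_assoc]; omega
  obtain ⟨ρ, hρ⟩ : ∃ ρ : ℤ, ρ = -(-(p : ℤ) ^ t) ^ s := ⟨_, rfl⟩
  have hρσ : σ * (p : ℝ) ^ (m / 2) = ρ := by
    rw [hσ, hρ, hm2, pow_mul]
    push_cast
    rw [neg_pow ((p : ℝ) ^ t)]
    ring
  have hρq : (Fintype.card F : ℤ) = ρ ^ 2 := by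
    rw [hF', hρ]
    push_cast
    rw [neg_sq, ← pow_mul, mul_comm s 2, pow_mul (-(p : ℤ) ^ t), neg_sq]
    ring
  have hρ1 : 1 < ρ ^ 2 := by
    rw [← hρq]
    exact_mod_cast Fintype.one_lt_card
  obtain ⟨l, hl⟩ : ∃ l : ℤ, k * l = -(ρ + 1) := by
    have h1 := sub_dvd_pow_sub_pow (1 : ℤ) (-(p : ℤ) ^ t) s
    rw [one_pow, sub_neg_eq_add] at h1
    have h2 : (k : ℤ) ∣ 1 + (p : ℤ) ^ t := by
      rw [add_comm]
      exact_mod_cast hkt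
    have h3 : (k : ℤ) ∣ -(ρ + 1) := by
      rw [dvd_neg, hρ, neg_add_eq_sub]
      exact h2.trans h1
    obtain ⟨l, hl⟩ := h3
    exact ⟨l, hl.symm⟩
  have hl0 : l ≠ 0 := by
    rintro rfl
    have : ρ = -1 := by linarith
    rw [this] at hρ1
    norm_num at hρ1
  -- `l = -1` means `ρ = k - 1`. For `k = 2` this gives `q = 1`; otherwise it is the excluded case
  -- `k = p ^ (m / 2) + 1`.
  have hl1 : l ≠ -1 := by
    rintro rfl
    have hρk : ρ = k - 1 := by linarith
    rcases hsemi with ⟨h, -⟩ | ⟨-, -, -, h⟩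
    · rw [hρk, h] at hρ1
      norm_num at hρ1
    · apply h
      have h1 : ρ ^ 2 = ((p : ℤ) ^ (m / 2)) ^ 2 := by
        rw [← hρq, hF', hm2]
        push_cast
        ring
      have h2 : ρ = (p : ℤ) ^ (m / 2) := by
        rwa [sq_eq_sq₀ (by omega) (by positivity)] at h1
      rw [hρk] at h2
      zify
      linarith
  obtain ⟨N, E, D, hN, hD, hE, hsrg⟩ := gpGraph_isSRGWith (F := F) hkt ht0 hF' hρ hl hl0
  have hneg := neg_one_mem_nonzeroPowers (F := F) hkt hF'
  set G := gpGraph F k with hG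
  have hkN : (k : ℤ) * N = ρ ^ 2 - 1 := by
    rw [hN]
    linear_combination (1 - ρ) * hl
  have hN0 : 0 < N := by
    rcases Nat.eq_zero_or_pos N with h | h
    · rw [h] at hkN
      norm_num at hkN
      omega
    · exact h
  have h2N : 2 * N + 1 ≤ Fintype.card F := by
    zify
    rw [hρq]
    have : (2 : ℤ) ≤ k := by exact_mod_cast hk2
    have : (2 : ℤ) * N ≤ k * N := mul_le_mul_of_nonneg_right this (Nat.cast_nonneg N)
    omega
  have hD0 : D ≠ 0 := by
    rintro rfl
    rcases mul_eq_zero.1 hD.symm with h | h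
    · exact hl0 h
    · exact hl1 (by omega)
  have hbot : G ≠ ⊥ := by
    intro h
    have h1 := hsrg.ncard_neighborSet 0
    simp only [h, SimpleGraph.bot_adj] at h1
    simp at h1
    omega
  have htop : G ≠ ⊤ := by
    intro h
    have h1 := hsrg.ncard_neighborSet 0
    have h2 : {z : F | G.Adj 0 z} = {0}ᶜ := by
      ext z
      simp [h, eq_comm]
    rw [h2, Set.ncard_compl, Set.ncard_singleton, Nat.card_eq_fintype_card] at h1
    omega
  -- Together with `h2N` and `hD0`, these two bounds ensure that no subtraction in the complement's
  -- natural-number parameters truncates.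
  have hEN := hsrg.le_of_ne_bot hbot
  have hDN := hsrg.le_of_ne_top htop
  have hsrg' := hsrg.compl
  have htop' : Gᶜ ≠ ⊤ := by simpa using hbot
  have hbot' : Gᶜ ≠ ⊥ := by simpa using htop
  obtain ⟨N', hN'⟩ : ∃ N', N' = Fintype.card F - N - 1 := ⟨_, rfl⟩
  obtain ⟨E', hE'⟩ : ∃ E', E' = Fintype.card F - (2 * N - D) - 2 := ⟨_, rfl⟩
  obtain ⟨D', hD'⟩ : ∃ D', D' = Fintype.card F - (2 * N - E) := ⟨_, rfl⟩
  rw [← hN', ← hE', ← hD'] at hsrg'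
  have hN'z : (N' : ℤ) = ρ ^ 2 - N - 1 := by omega
  have hE'z : (E' : ℤ) = ρ ^ 2 - 2 * N + D - 2 := by omega
  have hD'z : (D' : ℤ) = ρ ^ 2 - 2 * N + E := by omega
  have hD'0 : D' ≠ 0 := by omega
  have hdiam : G.ediam = 2 := hsrg.ediam_eq_two htop hD0
  have hdiam' : Gᶜ.ediam = 2 := hsrg'.ediam_eq_two htop' hD'0
  have hconn := SimpleGraph.connected_of_ediam_eq_two hdiam
  have hconn' := SimpleGraph.connected_of_ediam_eq_two hdiam'
  -- the real parameters are the casts of the integral ones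
  have hkR : (k : ℝ) ≠ 0 := by
    have : k ≠ 0 := by omega
    exact_mod_cast this
  have hqF : q = Fintype.card F := by rw [hq, hF]; push_cast; rfl
  have hqρ : q = (ρ : ℝ) ^ 2 := by rw [hqF]; exact_mod_cast hρq
  have hnN : n = N := by
    rw [hn, hqρ, div_eq_iff hkR, mul_comm]
    exact_mod_cast hkN.symm
  have hll : l₂ = l := by
    rw [hl₂, hρσ, ← neg_div, div_eq_iff hkR, mul_comm]
    exact_mod_cast hl.symm
  have hNR : (N : ℝ) = (1 - ρ) * l := by exact_mod_cast hN
  have hdD : d = D := by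
    have : (D : ℝ) = l * (l + 1) := by exact_mod_cast hD
    rw [hd, hρσ, hll, hnN, this, hNR]
    ring
  have heE : e = E := by
    have h1 : (E : ℝ) = l * (l + 1) + ρ + 2 * l := by exact_mod_cast hE
    have h2 : (D : ℝ) = l * (l + 1) := by exact_mod_cast hD
    rw [he, hρσ, hll, hdD, h1, h2]
    ring
  have hnN' : (k - 1) * n = N' := by
    have h1 : (N' : ℝ) = ρ ^ 2 - N - 1 := by exact_mod_cast hN'z
    have h2 : (k : ℝ) * N = ρ ^ 2 - 1 := by exact_mod_cast hkN
    rw [h1, hnN]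
    linear_combination h2
  have heE' : e' = E' := by
    have h1 : (E' : ℝ) = ρ ^ 2 - 2 * N + D - 2 := by exact_mod_cast hE'z
    rw [he', h1, hqρ, hnN, hdD]
    ring
  have hdD' : d' = D' := by
    have h1 : (D' : ℝ) = ρ ^ 2 - 2 * N + E := by exact_mod_cast hD'z
    rw [hd', h1, hqρ, hnN, heE]
  have hsum : l + (l + ρ) = (E : ℤ) - D := by rw [hE, hD]; ring
  have hprod : l * (l + ρ) = (D : ℤ) - N := by rw [hD, hN]; ring
  -- On vectors of sum zero the complement acts as `-1 - A`, which turns the eigenvalues `l`, `l +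
  -- ρ` into these.
  have hsum' : (-1 - l) + (-1 - (l + ρ)) = (E' : ℤ) - D' := by rw [hE'z, hD'z, hE, hD]; ring
  have hprod' : (-1 - l) * (-1 - (l + ρ)) = (D' : ℤ) - N' := by
    rw [hD'z, hN'z, hE, hN]; ring
  refine ⟨fun u v => gpGraph_adj_iff hneg,
    ⟨hsrg.isStronglyRegular htop hbot hqF hnN heE hdD, ⟨hconn, hconn'⟩,
      SimpleGraph.not_isBipartite_of_ediam_eq_two hdiam hconn', hsrg.isIntegral hsum hprod⟩,
    ⟨hsrg'.isStronglyRegular htop' hbot' hqF hnN' heE' hdD',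
      ⟨hconn', by rwa [compl_compl]⟩,
      SimpleGraph.not_isBipartite_of_ediam_eq_two hdiam' (by rwa [compl_compl]),
      hsrg'.isIntegral hsum' hprod'⟩,
    ⟨hsrg.isDistanceRegular hdiam, by simp [SimpleGraph.diam, hdiam],
      hsrg.hasIntersectionArray hdiam hnN (by rw [hnN, heE]) rfl hdD⟩,
    ⟨hsrg'.isDistanceRegular hdiam', by simp [SimpleGraph.diam, hdiam'],
      hsrg'.hasIntersectionArray hdiam' hnN' ?_ rfl (by rw [← hd', hdD'])⟩, fun hs => ?_⟩
  · have h1 : (N' : ℝ) = ρ ^ 2 - N - 1 := by exact_mod_cast hN'z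
    have h2 : (E' : ℝ) = ρ ^ 2 - 2 * N + D - 2 := by exact_mod_cast hE'z
    rw [h1, h2, hnN, hdD]
    ring
  have hρpos : 0 < ρ := by
    rw [hρ, hs.neg_pow, neg_neg]
    have := hp.pos
    positivity
  have hρ2 : 2 ≤ ρ := by
    have : ρ ≠ 1 := by
      intro h
      rw [h] at hρ1
      norm_num at hρ1
    omega
  have hk2z : (2 : ℤ) ≤ k := by exact_mod_cast hk2
  have hlneg : l < 0 := by
    by_contra! h
    have := mul_nonneg (by omega : (0 : ℤ) ≤ k) h
    omega
  -- Here `k * (l + ρ) = (k - 1) * ρ - 1`, which is positive since `k ≥ 2` and `ρ ≥ 2`.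
  have hτpos : 0 < l + ρ := by
    by_contra! h
    have h1 : (k : ℤ) * (l + ρ) ≤ 0 := mul_nonpos_of_nonneg_of_nonpos (by omega) h
    have h2 : (k : ℤ) * (l + ρ) = (k - 1) * ρ - 1 := by linear_combination hl
    have h3 : 1 * 2 ≤ ((k : ℤ) - 1) * ρ := mul_le_mul (by omega) hρ2 (by norm_num) (by omega)
    omega
  constructor
  · refine hsrg.isSpectralPseudoLatinSquare htop hbot (f := l + ρ) (g := l) hτpos hlneg ?_ ?_ ?_
      ?_ ?_ hnN
    · rw [hN]
      intro h
      have h1 : ρ * (l + 1) = 0 := by linear_combination h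
      rcases mul_eq_zero.1 h1 with h2 | h2 <;> omega
    · rw [hρq]; ring
    · rw [hN]; ring
    · rw [hE]; ring
    · rw [hD]
  · refine hsrg'.isSpectralPseudoLatinSquare htop' hbot' (f := -1 - l) (g := -1 - (l + ρ))
      (by omega) (by omega) ?_ ?_ ?_ ?_ ?_ hnN'
    · rw [hN'z, hN]
      intro h
      have h1 : ρ * (l + ρ) = 0 := by linear_combination -h
      rcases mul_eq_zero.1 h1 with h2 | h2 <;> omega
    · rw [hρq]; ring
    · rw [hN'z, hN]; ring
    · rw [hE'z, hN, hD]; ring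
    · rw [hD'z, hN, hE]; ring
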